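/- Let $q>0$ be real, $q\neq 1$, $h=\sqrt q-1/\sqrt q$, and let all indices run over $-,0,+$, with summation over repeated indices. Let $\mathcal A$ be the unital complex algebra generated by $x^-,x^0,x^+$ and the inverse $r^{-2}$ of $r^2=g_{ij}x^ix^j=\sqrt q\,x^+x^-+(x^0)^2+\tfrac1{\sqrt q}x^-x^+$, with relations $x^-x^0=q\,x^0x^-$, $x^+x^0=q^{-1}x^0x^+$, $[x^+,x^-]=h\,(x^0)^2$ (here $g_{-+}=1/\sqrt q$, $g_{00}=1$, $g_{+-}=\sqrt q$, all other $g_{ij}=0$, and $g^{ij}=g_{ij}$). Let $\hat R=q\mathcal P_s-q^{-1}\mathcal P_a+q^{-2}\mathcal P_t$ be the braid matrix of $SO_q(3)$, where $\mathcal P_a$ is the orthogonal projector onto the span of the coefficient vectors of the three quadratic relations above, $\mathcal P_t{}^{ij}_{kl}=g^{ij}g_{kl}/(g^{mn}g_{mn})$ and $\mathcal P_s=1-\mathcal P_a-\mathcal P_t$. Let $\Omega^1$ be the $\mathcal A$-bimodule which is free as a left module on $\xi^-,\xi^0,\xi^+$, with commutation relations $x^i\xi^j=q\hat R^{ij}_{kl}\,\xi^kx^l$;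 let $d:\mathcal A\to\Omega^1$ be the derivation with $dx^i=\xi^i$; let $\Omega^2$ be the quotient of $\Omega^1\otimes_{\mathcal A}\Omega^1$ by the sub-bimodule generated by $\mathcal P_s{}^{ij}_{kl}\,\xi^k\otimes\xi^l$ and $\mathcal P_t{}^{ij}_{kl}\,\xi^k\otimes\xi^l$, and let $\pi:\Omega^1\otimes_{\mathcal A}\Omega^1\to\Omega^2$ be the projection. Put $\theta=(q-1)^{-1}q^2r^{-2}x^i\xi^jg_{ij}$. A linear connection is a pair $(D,\sigma)$ of an additive map $D:\Omega^1\to\Omega^1\otimes_{\mathcal A}\Omega^1$ and an $\mathcal A$-bimodule map $\sigma:\Omega^1\otimes_{\mathcal A}\Omega^1\to\Omega^1\otimes_{\mathcal A}\Omega^1$ such that $D(f\xi)=df\otimes\xi+f\,D\xi$ and $D(\xi f)=\sigma(\xi\otimes df)+(D\xi)f$. Its extension is $D_2(\xi\otimes\eta)=D\xi\otimes\eta+(\sigma\otimes 1)(\xi\otimes D\eta)$ and its curvature is $\mathrm{Curv}=(\pi\otimes 1)\circ D_2\circ D:\Omega^1\to\Omega^2\otimes_{\mathcal A}\Omega^1$.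 Then, for each of the two matrices $S=q\hat R$ and $S=(q\hat R)^{-1}$, there is exactly one linear connection $(D_{(0)},\sigma_0)$ with $\sigma_0(\xi^i\otimes\xi^j)=S^{ij}{}_{hk}\,\xi^h\otimes\xi^k$ and $D_{(0)}\xi=-\theta\otimes\xi+\sigma_0(\xi\otimes\theta)$ for all $\xi\in\Omega^1$, and its curvature vanishes: $\mathrm{Curv}=0$. -/

import Mathlib

open scoped RightActions TensorProduct

/-! ## Bimodules over a noncommutative ring -/

section Bimodules

/-- The subgroup of `M ⊗[ℤ] N` generated by the elements `m a ⊗ n - m ⊗ a n`. -/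
def balancedRel (A M N : Type*) [Ring A] [AddCommGroup M] [Module Aᵐᵒᵖ M]
    [AddCommGroup N] [Module A N] : AddSubgroup (M ⊗[ℤ] N) :=
  AddSubgroup.closure {t | ∃ (m : M) (a : A) (n : N), t = (m <• a) ⊗ₜ[ℤ] n - m ⊗ₜ[ℤ] (a • n)}

/-- The tensor product `M ⊗_A N` of a right module `M` and a left module `N` over a
(noncommutative) ring `A`. -/
def BTensor (A M N : Type*) [Ring A] [AddCommGroup M] [Module Aᵐᵒᵖ M]
    [AddCommGroup N] [Module A N] : Type _ :=
  (M ⊗[ℤ] N) ⧸ balancedRel A M N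

namespace BTensor

variable {A M N P : Type*} [Ring A] [AddCommGroup M] [Module Aᵐᵒᵖ M]
  [AddCommGroup N] [Module A N] [AddCommGroup P]

instance : AddCommGroup (BTensor A M N) :=
  inferInstanceAs (AddCommGroup ((M ⊗[ℤ] N) ⧸ balancedRel A M N))

/-- The pure tensor `m ⊗ n` in `M ⊗_A N`. -/
def tmul (A : Type*) {M N : Type*} [Ring A] [AddCommGroup M] [Module Aᵐᵒᵖ M]
    [AddCommGroup N] [Module A N] (m : M) (n : N) : BTensor A M N :=
  QuotientAddGroup.mk (s := balancedRel A M N) (m ⊗ₜ[ℤ] n)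

theorem add_tmul (m m' : M) (n : N) : tmul A (m + m') n = tmul A m n + tmul A m' n := by
  unfold tmul; rw [TensorProduct.add_tmul]; rfl

theorem tmul_add (m : M) (n n' : N) : tmul A m (n + n') = tmul A m n + tmul A m n' := by
  unfold tmul; rw [TensorProduct.tmul_add]; rfl

theorem zero_tmul (n : N) : tmul A (0 : M) n = 0 := by
  have h := add_tmul (A := A) (0 : M) 0 n
  rwa [add_zero, left_eq_add] at h

theorem tmul_zero (m : M) : tmul A m (0 : N) = 0 := by
  have h := tmul_add (A := A) m (0 : N) 0
  rwa [add_zero, left_eq_add] at h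

theorem smul_tmul (m : M) (a : A) (n : N) : tmul A (m <• a) n = tmul A m (a • n) := by
  exact (QuotientAddGroup.eq_iff_sub_mem (N := balancedRel A M N)).2
    (AddSubgroup.subset_closure ⟨m, a, n, rfl⟩)

/-- The additive map out of `M ⊗_A N` induced by a balanced biadditive map. -/
def lift (f : M →+ N →+ P) (hf : ∀ m (a : A) n, f (m <• a) n = f m (a • n)) :
    BTensor A M N →+ P :=
  QuotientAddGroup.lift (balancedRel A M N)
    (TensorProduct.liftAddHom f (fun r m n => by simp)) (by
      intro t ht
      refine (AddSubgroup.closure_le (K := AddMonoidHom.ker _)).2 ?_ ht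
      rintro _ ⟨m, a, n, rfl⟩
      simp [AddMonoidHom.mem_ker, hf])

@[simp] theorem lift_tmul (f : M →+ N →+ P) (hf : ∀ m (a : A) n, f (m <• a) n = f m (a • n))
    (m : M) (n : N) : lift f hf (tmul A m n) = f m n := rfl

theorem induction {p : BTensor A M N → Prop} (t : BTensor A M N) (h0 : p 0)
    (ht : ∀ m n, p (tmul A m n)) (ha : ∀ s t, p s → p t → p (s + t)) : p t := by
  obtain ⟨t, rfl⟩ := QuotientAddGroup.mk_surjective t
  induction t using TensorProduct.induction_on with
  | zero => exact h0
  | tmul m n => exact ht m n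
  | add s t hs ht => exact ha _ _ hs ht

theorem hom_ext {f g : BTensor A M N →+ P} (h : ∀ m n, f (tmul A m n) = g (tmul A m n)) :
    f = g := by
  ext t
  induction t using BTensor.induction with
  | h0 => simp
  | ht m n => exact h m n
  | ha s t hs ht => simp [hs, ht]

/-- The biadditive map `(m, n) ↦ m ⊗ n`. -/
def mk (A M N : Type*) [Ring A] [AddCommGroup M] [Module Aᵐᵒᵖ M]
    [AddCommGroup N] [Module A N] : M →+ N →+ BTensor A M N :=
  AddMonoidHom.mk' (fun m => AddMonoidHom.mk' (tmul A m) (tmul_add m))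
    (fun m m' => by ext n; exact add_tmul m m' n)

@[simp] theorem mk_apply (m : M) (n : N) : mk A M N m n = tmul A m n := rfl

/-- `f ⊗ g` for a right linear map `f` and a left linear map `g`. -/
def map {M' N' : Type*} [AddCommGroup M'] [Module Aᵐᵒᵖ M'] [AddCommGroup N'] [Module A N']
    (f : M →+ M') (hf : ∀ m (a : A), f (m <• a) = f m <• a)
    (g : N →+ N') (hg : ∀ (a : A) n, g (a • n) = a • g n) :
    BTensor A M N →+ BTensor A M' N' :=
  lift (((mk A M' N').compl₂ g).comp f) (by intro m a n; simp [hf, hg, smul_tmul])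

@[simp] theorem map_tmul {M' N' : Type*} [AddCommGroup M'] [Module Aᵐᵒᵖ M'] [AddCommGroup N']
    [Module A N'] (f : M →+ M') (hf : ∀ m (a : A), f (m <• a) = f m <• a)
    (g : N →+ N') (hg : ∀ (a : A) n, g (a • n) = a • g n) (m : M) (n : N) :
    map f hf g hg (tmul A m n) = tmul A (f m) (g n) := rfl

section Left
variable [Module A M] [SMulCommClass A Aᵐᵒᵖ M]

instance : SMul A (BTensor A M N) where
  smul a t := map (A := A) (N := N) (DistribSMul.toAddMonoidHom M a)
    (fun m b => smul_comm a (MulOpposite.op b) m) (AddMonoidHom.id N) (fun _ _ => rfl) t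

theorem smul_def (a : A) (t : BTensor A M N) :
    a • t = map (A := A) (N := N) (DistribSMul.toAddMonoidHom M a)
    (fun m b => smul_comm a (MulOpposite.op b) m) (AddMonoidHom.id N) (fun _ _ => rfl) t := rfl

@[simp] theorem left_smul_tmul (a : A) (m : M) (n : N) : a • tmul A m n = tmul A (a • m) n := rfl

instance : Module A (BTensor A M N) where
  smul_zero a := by rw [smul_def, map_zero]
  smul_add a s t := by simp only [smul_def, map_add]
  one_smul t := by
    induction t using BTensor.induction with
    | h0 => rw [smul_def, map_zero]
    | ht m n => simp
    | ha s t hs ht => rw [smul_def, map_add, ← smul_def, ← smul_def, hs, ht]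
  mul_smul a b t := by
    induction t using BTensor.induction with
    | h0 => simp only [smul_def, map_zero]
    | ht m n => simp [mul_smul]
    | ha s t hs ht => simp only [smul_def, map_add] at *; rw [hs, ht]
  add_smul a b t := by
    induction t using BTensor.induction with
    | h0 => simp only [smul_def, map_zero, add_zero]
    | ht m n => simp [add_smul, add_tmul]
    | ha s t hs ht => simp only [smul_def, map_add] at *; rw [hs, ht]; abel
  zero_smul t := by
    induction t using BTensor.induction with
    | h0 => simp only [smul_def, map_zero]
    | ht m n => simp [zero_tmul]
    | ha s t hs ht => simp only [smul_def, map_add] at *; rw [hs, ht, add_zero]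

end Left

section Right
variable [Module Aᵐᵒᵖ N] [SMulCommClass A Aᵐᵒᵖ N]

instance : SMul Aᵐᵒᵖ (BTensor A M N) where
  smul b t := map (A := A) (M := M) (AddMonoidHom.id M) (fun _ _ => rfl)
    (DistribSMul.toAddMonoidHom N b) (fun a n => (smul_comm a b n).symm) t

theorem op_smul_def (b : Aᵐᵒᵖ) (t : BTensor A M N) :
    b • t = map (A := A) (M := M) (AddMonoidHom.id M) (fun _ _ => rfl)
    (DistribSMul.toAddMonoidHom N b) (fun a n => (smul_comm a b n).symm) t := rfl

@[simp] theorem op_smul_tmul (b : Aᵐᵒᵖ) (m : M) (n : N) :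
    b • tmul A m n = tmul A m (b • n) := rfl

instance : Module Aᵐᵒᵖ (BTensor A M N) where
  smul_zero a := by rw [op_smul_def, map_zero]
  smul_add a s t := by simp only [op_smul_def, map_add]
  one_smul t := by
    induction t using BTensor.induction with
    | h0 => rw [op_smul_def, map_zero]
    | ht m n => simp
    | ha s t hs ht => rw [op_smul_def, map_add, ← op_smul_def, ← op_smul_def, hs, ht]
  mul_smul a b t := by
    induction t using BTensor.induction with
    | h0 => simp only [op_smul_def, map_zero]
    | ht m n => simp [mul_smul]
    | ha s t hs ht => simp only [op_smul_def, map_add] at *; rw [hs, ht]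
  add_smul a b t := by
    induction t using BTensor.induction with
    | h0 => simp only [op_smul_def, map_zero, add_zero]
    | ht m n => simp [add_smul, tmul_add]
    | ha s t hs ht => simp only [op_smul_def, map_add] at *; rw [hs, ht]; abel
  zero_smul t := by
    induction t using BTensor.induction with
    | h0 => simp only [op_smul_def, map_zero]
    | ht m n => simp [tmul_zero]
    | ha s t hs ht => simp only [op_smul_def, map_add] at *; rw [hs, ht, add_zero]

instance [Module A M] [SMulCommClass A Aᵐᵒᵖ M] : SMulCommClass A Aᵐᵒᵖ (BTensor A M N) where
  smul_comm a b t := by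
    induction t using BTensor.induction with
    | h0 => simp only [smul_zero]
    | ht m n => simp
    | ha s t hs ht => simp only [smul_add, hs, ht]

end Right

/-- The canonical map `L ⊗_A (M ⊗_A N) → (L ⊗_A M) ⊗_A N`, `l ⊗ (m ⊗ n) ↦ (l ⊗ m) ⊗ n`. -/
def assocInv (A L M N : Type*) [Ring A] [AddCommGroup L] [Module Aᵐᵒᵖ L]
    [AddCommGroup M] [Module A M] [Module Aᵐᵒᵖ M] [SMulCommClass A Aᵐᵒᵖ M]
    [AddCommGroup N] [Module A N] :
    BTensor A L (BTensor A M N) →+ BTensor A (BTensor A L M) N :=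
  lift (AddMonoidHom.mk'
    (fun l => map (A := A) (mk A L M l) (fun _ _ => rfl) (AddMonoidHom.id N) (fun _ _ => rfl))
    (fun l l' => hom_ext (fun m n => by
      change tmul A (tmul A (l + l') m) n = tmul A (tmul A l m) n + tmul A (tmul A l' m) n
      rw [add_tmul, add_tmul]))) (by
      intro l a t
      induction t using BTensor.induction with
      | h0 => simp
      | ht m n =>
        change tmul A (tmul A (l <• a) m) n = tmul A (tmul A l (a • m)) n
        rw [smul_tmul]
      | ha s t hs ht => simp only [smul_add, map_add, hs, ht])

@[simp] theorem assocInv_tmul {L : Type*} [AddCommGroup L] [Module Aᵐᵒᵖ L] [Module Aᵐᵒᵖ N]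
    [SMulCommClass A Aᵐᵒᵖ N] [Module A P] (l : L) (n : N) (p : P) :
    assocInv A L N P (tmul A l (tmul A n p)) = tmul A (tmul A l n) p := rfl

end BTensor

/-- The sub-bimodule of an `A`-bimodule `M` generated by a set `s`. -/
def subBimodule (A : Type*) {M : Type*} [Ring A] [AddCommGroup M] [Module A M] [Module Aᵐᵒᵖ M]
    (s : Set M) : Submodule A M :=
  Submodule.span A {t | ∃ m ∈ s, ∃ b : A, t = m <• b}

section Quotient

variable {A M : Type*} [Ring A] [AddCommGroup M] [Module A M] [Module Aᵐᵒᵖ M]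
  [SMulCommClass A Aᵐᵒᵖ M]

theorem op_smul_mem_subBimodule (s : Set M) (b : Aᵐᵒᵖ) {t : M} (ht : t ∈ subBimodule A s) :
    b • t ∈ subBimodule A s := by
  induction ht using Submodule.span_induction with
  | mem t ht =>
    obtain ⟨m, hm, c, rfl⟩ := ht
    exact Submodule.subset_span ⟨m, hm, c * b.unop, by
      rw [MulOpposite.op_mul, mul_smul, MulOpposite.op_unop]⟩
  | zero => rw [smul_zero]; exact zero_mem _
  | add x y _ _ hx hy => rw [smul_add]; exact add_mem hx hy
  | smul a x _ hx => rw [← smul_comm a b x]; exact Submodule.smul_mem _ _ hx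

/-- The quotient of a bimodule by the sub-bimodule generated by `s`. -/
def QuotBimodule (A : Type*) {M : Type*} [Ring A] [AddCommGroup M] [Module A M]
    [Module Aᵐᵒᵖ M] (s : Set M) : Type _ := M ⧸ subBimodule A s

instance (s : Set M) : AddCommGroup (QuotBimodule A s) :=
  inferInstanceAs (AddCommGroup (M ⧸ subBimodule A s))

instance (s : Set M) : Module A (QuotBimodule A s) :=
  inferInstanceAs (Module A (M ⧸ subBimodule A s))

/-- The canonical projection. -/
def QuotBimodule.proj (s : Set M) : M →ₗ[A] QuotBimodule A s := (subBimodule A s).mkQ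

instance (s : Set M) : SMul Aᵐᵒᵖ (QuotBimodule A s) where
  smul b := (subBimodule A s).mapQ (subBimodule A s)
    ({ toFun := fun t => b • t, map_add' := smul_add b,
       map_smul' := fun a t => (smul_comm a b t).symm } : M →ₗ[A] M)
    (fun _ ht => op_smul_mem_subBimodule s b ht)

theorem QuotBimodule.proj_op_smul (s : Set M) (b : Aᵐᵒᵖ) (t : M) :
    QuotBimodule.proj (A := A) s (b • t) = b • QuotBimodule.proj (A := A) s t := rfl

instance (s : Set M) : Module Aᵐᵒᵖ (QuotBimodule A s) :=
  Function.Surjective.module Aᵐᵒᵖ (QuotBimodule.proj (A := A) s).toAddMonoidHom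
    (subBimodule A s).mkQ_surjective (QuotBimodule.proj_op_smul s)

instance (s : Set M) : SMulCommClass A Aᵐᵒᵖ (QuotBimodule A s) where
  smul_comm a b t := by
    obtain ⟨t, rfl⟩ := (subBimodule A s).mkQ_surjective t
    change a • b • QuotBimodule.proj s t = b • a • QuotBimodule.proj s t
    rw [← QuotBimodule.proj_op_smul, ← map_smul, ← map_smul, ← QuotBimodule.proj_op_smul,
      smul_comm]

end Quotient

end Bimodules

/-! ## Linear connections and curvature -/

section Connections

variable {A Ω : Type*} [Ring A] [AddCommGroup Ω] [Module A Ω] [Module Aᵐᵒᵖ Ω]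
  [SMulCommClass A Aᵐᵒᵖ Ω]

/-- A linear connection on the bimodule of one-forms `Ω`, for the differential `d : A → Ω`:
an additive map `D : Ω → Ω ⊗_A Ω` together with a generalized flip, that is a bimodule map
`σ : Ω ⊗_A Ω → Ω ⊗_A Ω`, satisfying the left and the right Leibniz rule. -/
@[ext]
structure LinearConnection (d : A →+ Ω) where
  D : Ω →+ BTensor A Ω Ω
  σ : BTensor A Ω Ω →+ BTensor A Ω Ω
  σ_left : ∀ (a : A) t, σ (a • t) = a • σ t
  σ_right : ∀ t (a : A), σ (t <• a) = σ t <• a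
  leibniz_left : ∀ (f : A) (ω : Ω), D (f • ω) = BTensor.tmul A (d f) ω + f • D ω
  leibniz_right : ∀ (ω : Ω) (f : A), D (ω <• f) = σ (BTensor.tmul A ω (d f)) + D ω <• f

namespace LinearConnection

variable {d : A →+ Ω} (C : LinearConnection d)

/-- `σ₁₂ = σ ⊗ 1`. -/
def σ12 : BTensor A (BTensor A Ω Ω) Ω →+ BTensor A (BTensor A Ω Ω) Ω :=
  BTensor.map C.σ C.σ_right (AddMonoidHom.id Ω) (fun _ _ => rfl)

/-- The extension `D₂ (ξ ⊗ η) = D ξ ⊗ η + σ₁₂ (ξ ⊗ D η)` of the connection to `Ω ⊗_A Ω`. -/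
def D₂ : BTensor A Ω Ω →+ BTensor A (BTensor A Ω Ω) Ω :=
  BTensor.lift
    ((BTensor.mk A (BTensor A Ω Ω) Ω).comp C.D +
      AddMonoidHom.mk' (fun ω => (C.σ12.comp (BTensor.assocInv A Ω Ω Ω)).comp
          ((BTensor.mk A Ω (BTensor A Ω Ω) ω).comp C.D))
        (fun ω ω' => by ext η; simp))
    (by
      intro ω a η
      simp [C.leibniz_left, C.leibniz_right, BTensor.tmul_add,
        BTensor.smul_tmul, σ12]
      abel)

theorem D₂_tmul (ξ η : Ω) : C.D₂ (BTensor.tmul A ξ η) =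
    BTensor.tmul A (C.D ξ) η + C.σ12 (BTensor.assocInv A Ω Ω Ω (BTensor.tmul A ξ (C.D η))) := rfl

/-- The curvature `Curv = π₁₂ ∘ D₂ ∘ D : Ω → Ω² ⊗_A Ω`, where `π : Ω ⊗_A Ω → Ω²` is the
projection and `π₁₂ = π ⊗ 1`. -/
def curvature {Ω₂ : Type*} [AddCommGroup Ω₂] [Module Aᵐᵒᵖ Ω₂] (π : BTensor A Ω Ω →+ Ω₂)
    (hπ : ∀ t (a : A), π (t <• a) = π t <• a) : Ω →+ BTensor A Ω₂ Ω :=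
  ((BTensor.map π hπ (AddMonoidHom.id Ω) (fun _ _ => rfl)).comp C.D₂).comp C.D

end LinearConnection

end Connections

/-! ## The quantum Euclidean space -/

namespace QEuclid

open Matrix

/-- `√q` as a complex number. The indices `-, 0, +` are encoded as `0, 1, 2 : Fin 3`. -/
noncomputable def sq (q : ℝ) : ℂ := (Real.sqrt q : ℂ)

/-- `h = √q - 1/√q`. -/
noncomputable def hpar (q : ℝ) : ℂ := sq q - 1 / sq q

/-- The `SO_q(3)`-covariant metric `g_{ij} = g^{ij}`. -/
noncomputable def metric (q : ℝ) : Matrix (Fin 3) (Fin 3) ℂ :=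
  !![0, 0, 1 / sq q; 0, 1, 0; sq q, 0, 0]

/-- The generators of the coordinate algebra: `x⁻, x⁰, x⁺` and `r⁻²`. -/
inductive Gen
  | x (i : Fin 3)
  | rinv

/-- `r² = g_{ij} x^i x^j` in the free algebra. -/
noncomputable def freeR2 (q : ℝ) : FreeAlgebra ℂ Gen :=
  ∑ i, ∑ j, metric q i j • (FreeAlgebra.ι ℂ (Gen.x i) * FreeAlgebra.ι ℂ (Gen.x j))

open FreeAlgebra in
/-- The defining relations of the coordinate algebra. -/
inductive Rel (q : ℝ) : FreeAlgebra ℂ Gen → FreeAlgebra ℂ Gen → Prop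
  | minus_zero : Rel q (ι ℂ (Gen.x 0) * ι ℂ (Gen.x 1)) ((q : ℂ) • (ι ℂ (Gen.x 1) * ι ℂ (Gen.x 0)))
  | plus_zero : Rel q (ι ℂ (Gen.x 2) * ι ℂ (Gen.x 1))
      ((q : ℂ)⁻¹ • (ι ℂ (Gen.x 1) * ι ℂ (Gen.x 2)))
  | plus_minus : Rel q (ι ℂ (Gen.x 2) * ι ℂ (Gen.x 0) - ι ℂ (Gen.x 0) * ι ℂ (Gen.x 2))
      (hpar q • (ι ℂ (Gen.x 1) * ι ℂ (Gen.x 1)))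
  | inv_mul : Rel q (ι ℂ Gen.rinv * freeR2 q) 1
  | mul_inv : Rel q (freeR2 q * ι ℂ Gen.rinv) 1

/-- The algebra of functions on the quantum Euclidean space `ℝ_q³`, with the inverse of the
central element `r²` adjoined. -/
def Alg (q : ℝ) : Type := RingQuot (Rel q)

noncomputable instance (q : ℝ) : Ring (Alg q) := inferInstanceAs (Ring (RingQuot (Rel q)))

noncomputable instance (q : ℝ) : Algebra ℂ (Alg q) :=
  inferInstanceAs (Algebra ℂ (RingQuot (Rel q)))

/-- The projection from the free algebra. -/
noncomputable def mkAlg (q : ℝ) : FreeAlgebra ℂ Gen →ₐ[ℂ] Alg q := RingQuot.mkAlgHom ℂ (Rel q)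

/-- The coordinates `x^i`. -/
noncomputable def x (q : ℝ) (i : Fin 3) : Alg q := mkAlg q (FreeAlgebra.ι ℂ (Gen.x i))

/-- The element `r⁻²`. -/
noncomputable def rinv2 (q : ℝ) : Alg q := mkAlg q (FreeAlgebra.ι ℂ Gen.rinv)

/-- `r² = g_{ij} x^i x^j`. -/
noncomputable def r2 (q : ℝ) : Alg q := ∑ i, ∑ j, metric q i j • (x q i * x q j)

section AlgFacts
variable (q : ℝ)

theorem mkAlg_rel {a b : FreeAlgebra ℂ Gen} (h : Rel q a b) : mkAlg q a = mkAlg q b :=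
  RingQuot.mkAlgHom_rel ℂ h

theorem x_minus_zero : x q 0 * x q 1 = (q : ℂ) • (x q 1 * x q 0) := by
  simpa only [x, map_mul, map_smul] using mkAlg_rel q Rel.minus_zero

theorem x_plus_zero : x q 2 * x q 1 = (q : ℂ)⁻¹ • (x q 1 * x q 2) := by
  simpa only [x, map_mul, map_smul] using mkAlg_rel q Rel.plus_zero

theorem x_plus_minus : x q 2 * x q 0 - x q 0 * x q 2 = hpar q • (x q 1 * x q 1) := by
  simpa only [x, map_sub, map_mul, map_smul] using mkAlg_rel q Rel.plus_minus

theorem mkAlg_freeR2 : mkAlg q (freeR2 q) = r2 q := by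
  simp [freeR2, r2, x]

theorem rinv2_mul_r2 : rinv2 q * r2 q = 1 := by
  simpa [rinv2, mkAlg_freeR2] using mkAlg_rel q Rel.inv_mul

theorem r2_mul_rinv2 : r2 q * rinv2 q = 1 := by
  simpa [rinv2, mkAlg_freeR2] using mkAlg_rel q Rel.mul_inv

/-- The universal property of the coordinate algebra. -/
noncomputable def liftAlg {B : Type*} [Ring B] [Algebra ℂ B] (X : Fin 3 → B) (Y : B)
    (h1 : X 0 * X 1 = (q : ℂ) • (X 1 * X 0))
    (h2 : X 2 * X 1 = (q : ℂ)⁻¹ • (X 1 * X 2))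
    (h3 : X 2 * X 0 - X 0 * X 2 = hpar q • (X 1 * X 1))
    (h4 : Y * ∑ i, ∑ j, metric q i j • (X i * X j) = 1)
    (h5 : (∑ i, ∑ j, metric q i j • (X i * X j)) * Y = 1) : Alg q →ₐ[ℂ] B :=
  RingQuot.liftAlgHom ℂ (s := Rel q) ⟨FreeAlgebra.lift ℂ (fun | .x i => X i | .rinv => Y), by
    intro a b h
    cases h
    · simpa only [map_sub, map_mul, map_smul, FreeAlgebra.lift_ι_apply] using h1
    · simpa only [map_sub, map_mul, map_smul, FreeAlgebra.lift_ι_apply] using h2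
    · simpa only [map_sub, map_mul, map_smul, FreeAlgebra.lift_ι_apply] using h3
    · simpa [freeR2] using h4
    · simpa [freeR2] using h5⟩

theorem liftAlg_x {B : Type*} [Ring B] [Algebra ℂ B] (X : Fin 3 → B) (Y : B) (h1 h2 h3 h4 h5)
    (i : Fin 3) : liftAlg q X Y h1 h2 h3 h4 h5 (x q i) = X i := by
  simp only [liftAlg, x, mkAlg]
  erw [RingQuot.liftAlgHom_mkAlgHom_apply]
  simp

theorem liftAlg_rinv2 {B : Type*} [Ring B] [Algebra ℂ B] (X : Fin 3 → B) (Y : B)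
    (h1 h2 h3 h4 h5) : liftAlg q X Y h1 h2 h3 h4 h5 (rinv2 q) = Y := by
  simp only [liftAlg, rinv2, mkAlg]
  erw [RingQuot.liftAlgHom_mkAlgHom_apply]
  simp

theorem hom_ext_alg {B : Type*} [Ring B] [Algebra ℂ B] {f g : Alg q →ₐ[ℂ] B}
    (hx : ∀ i, f (x q i) = g (x q i)) (hr : f (rinv2 q) = g (rinv2 q)) : f = g := by
  refine RingQuot.ringQuot_ext' ℂ (s := Rel q) f g (FreeAlgebra.hom_ext ?_)
  funext t
  cases t with
  | x i => exact hx i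
  | rinv => exact hr

end AlgFacts

/-! ### The braid matrix -/

/-- The coefficients of the three quadratic relations
`x⁻x⁰ - q x⁰x⁻`, `x⁰x⁺ - q x⁺x⁰`, `x⁺x⁻ - x⁻x⁺ - h (x⁰)²`. -/
noncomputable def eps (q : ℝ) : Fin 3 → Matrix (Fin 3) (Fin 3) ℂ :=
  ![!![0, 1, 0; -q, 0, 0; 0, 0, 0], !![0, 0, 0; 0, 0, 1; 0, -q, 0],
    !![0, 0, -1; 0, -hpar q, 0; 1, 0, 0]]

/-- The `q`-antisymmetric projector `(P_a)^{ij}_{kl}`: the orthogonal projector onto the span of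
the coefficient vectors of the three quadratic relations (which are pairwise orthogonal), so that
the relations read `P_a x x = 0`. Rows are the upper, columns the lower pairs of indices. -/
noncomputable def projA (q : ℝ) : Matrix (Fin 3 × Fin 3) (Fin 3 × Fin 3) ℂ :=
  .of fun ij kl => ∑ c, eps q c ij.1 ij.2 * eps q c kl.1 kl.2 / ∑ m, ∑ n, eps q c m n ^ 2

/-- The trace projector `(P_t)^{ij}_{kl} = g^{ij} g_{kl} / (g^{mn} g_{mn})`. -/
noncomputable def projT (q : ℝ) : Matrix (Fin 3 × Fin 3) (Fin 3 × Fin 3) ℂ :=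
  .of fun ij kl => metric q ij.1 ij.2 * metric q kl.1 kl.2 / ∑ m, ∑ n, metric q m n ^ 2

/-- The `q`-symmetric trace-free projector `P_s = 1 - P_a - P_t`. -/
noncomputable def projS (q : ℝ) : Matrix (Fin 3 × Fin 3) (Fin 3 × Fin 3) ℂ :=
  1 - projA q - projT q

/-- The braid matrix `R̂ = q P_s - q⁻¹ P_a + q⁻² P_t` of `SO_q(3)`. -/
noncomputable def braid (q : ℝ) : Matrix (Fin 3 × Fin 3) (Fin 3 × Fin 3) ℂ :=
  (q : ℂ) • projS q - (q : ℂ)⁻¹ • projA q + ((q : ℂ) ^ 2)⁻¹ • projT q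

section BraidFacts
variable (q : ℝ)

theorem sq_sq (h : 0 < q) : (q : ℂ) = sq q ^ 2 := by
  rw [sq, ← Complex.ofReal_pow, Real.sq_sqrt h.le]

theorem sq_ne (h : 0 < q) : sq q ≠ 0 := by
  rw [sq]; exact_mod_cast (Real.sqrt_pos.2 h).ne'

theorem den1 (h : 0 < q) : 1 + sq q ^ 4 ≠ 0 := by
  rw [sq]; exact_mod_cast (by positivity : (1 + √q ^ 4 : ℝ) ≠ 0)

theorem den2 (h : 0 < q) : 1 + sq q ^ 2 + sq q ^ 4 ≠ 0 := by
  rw [sq]; exact_mod_cast (by positivity : (1 + √q ^ 2 + √q ^ 4 : ℝ) ≠ 0)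

theorem normE0 (h : 0 < q) : ∑ m, ∑ n, eps q 0 m n ^ 2 = 1 + sq q ^ 4 := by
  simp [eps, Fin.sum_univ_three, sq_sq q h]; ring

theorem normE1 (h : 0 < q) : ∑ m, ∑ n, eps q 1 m n ^ 2 = 1 + sq q ^ 4 := by
  simp [eps, Fin.sum_univ_three, sq_sq q h]; ring

theorem normE2 (h : 0 < q) : ∑ m, ∑ n, eps q 2 m n ^ 2 = (1 + sq q ^ 4) / sq q ^ 2 := by
  have := sq_ne q h
  simp [eps, Fin.sum_univ_three, hpar]; field_simp; ring

theorem normG (h : 0 < q) : ∑ m, ∑ n, metric q m n ^ 2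
    = (1 + sq q ^ 2 + sq q ^ 4) / sq q ^ 2 := by
  have := sq_ne q h
  simp [metric, Fin.sum_univ_three]; field_simp

/-- A matrix with the pattern of `R̂` and of its inverse. -/
def pat (a b c d e f g u v w : ℂ) : Matrix (Fin 3 × Fin 3) (Fin 3 × Fin 3) ℂ :=
  .of fun p r => match p, r with
    | (0, 0), (0, 0) => a
    | (2, 2), (2, 2) => a
    | (0, 1), (0, 1) => b
    | (1, 2), (1, 2) => b
    | (1, 0), (1, 0) => c
    | (2, 1), (2, 1) => c
    | (0, 1), (1, 0) => d
    | (1, 0), (0, 1) => d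
    | (1, 2), (2, 1) => d
    | (2, 1), (1, 2) => d
    | (0, 2), (0, 2) => e
    | (0, 2), (1, 1) => f
    | (1, 1), (0, 2) => f
    | (1, 1), (1, 1) => g
    | (0, 2), (2, 0) => u
    | (2, 0), (0, 2) => u
    | (2, 0), (1, 1) => v
    | (1, 1), (2, 0) => v
    | (2, 0), (2, 0) => w
    | _, _ => 0

theorem projA_mul_projA (h : 0 < q) : projA q * projA q = projA q := by
  have h0 := sq_ne q h
  have h1 := den1 q h
  let U : Matrix (Fin 3 × Fin 3) (Fin 3) ℂ := .of fun p c => eps q c p.1 p.2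
  let V : Matrix (Fin 3) (Fin 3 × Fin 3) ℂ :=
    .of fun c p => eps q c p.1 p.2 / ∑ m, ∑ n, eps q c m n ^ 2
  have hP : projA q = U * V := by
    ext p r; simp [projA, U, V, Matrix.mul_apply, mul_div_assoc]
  have hVU : V * U = 1 := by
    ext c d
    simp only [V, U, Matrix.mul_apply, Matrix.of_apply, Fintype.sum_prod_type]
    fin_cases c <;> fin_cases d <;>
      simp [normE0 q h, normE1 q h, normE2 q h] <;>
      simp [eps, Fin.sum_univ_three, hpar, sq_sq q h] <;> field_simp <;> ring_nf
  rw [hP, Matrix.mul_assoc, ← Matrix.mul_assoc V, hVU, Matrix.one_mul]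

theorem projT_mul_projT (h : 0 < q) : projT q * projT q = projT q := by
  have h2 := den2 q h
  have h0 := sq_ne q h
  have hn : ∑ m, ∑ n, metric q m n ^ 2 ≠ 0 := by rw [normG q h]; positivity
  ext p r
  simp only [projT, Matrix.mul_apply, Matrix.of_apply]
  generalize hN : ∑ m, ∑ n, metric q m n ^ 2 = N at *
  have : ∀ t : Fin 3 × Fin 3, metric q p.1 p.2 * metric q t.1 t.2 / N *
      (metric q t.1 t.2 * metric q r.1 r.2 / N) =
      metric q p.1 p.2 * metric q r.1 r.2 / N ^ 2 * metric q t.1 t.2 ^ 2 := by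
    intro t; field_simp
  simp only [this, ← Finset.mul_sum, Fintype.sum_prod_type, hN]
  field_simp

theorem eps_metric (h : 0 < q) (c : Fin 3) :
    ∑ t : Fin 3 × Fin 3, eps q c t.1 t.2 * metric q t.1 t.2 = 0 := by
  have h0 := sq_ne q h
  rw [Fintype.sum_prod_type]
  fin_cases c <;> simp [eps, metric, Fin.sum_univ_three, hpar] <;> ring

theorem projA_mul_projT (h : 0 < q) : projA q * projT q = 0 := by
  ext p r
  simp only [projA, projT, Matrix.mul_apply, Matrix.of_apply, Matrix.zero_apply, Finset.sum_mul]
  rw [Finset.sum_comm]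
  refine Finset.sum_eq_zero fun c _ => ?_
  rw [← mul_zero (eps q c p.1 p.2 * metric q r.1 r.2 / (∑ m, ∑ n, eps q c m n ^ 2) /
    ∑ m, ∑ n, metric q m n ^ 2), ← eps_metric q h c, Finset.mul_sum]
  refine Finset.sum_congr rfl fun t _ => by ring

theorem projT_mul_projA (h : 0 < q) : projT q * projA q = 0 := by
  have hA : (projA q)ᵀ = projA q := by ext p r; simp [projA, mul_comm]
  have hT : (projT q)ᵀ = projT q := by ext p r; simp [projT, mul_comm]
  rw [← hA, ← hT, ← Matrix.transpose_mul, projA_mul_projT q h, Matrix.transpose_zero]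

theorem braid_mul (h : 0 < q) : ((q : ℂ) • braid q) *
    (((q : ℂ) ^ 2)⁻¹ • projS q - projA q + (q : ℂ) • projT q) = 1 := by
  have h0 : (q : ℂ) ≠ 0 := by exact_mod_cast h.ne'
  simp only [braid, projS, Matrix.smul_mul, Matrix.mul_smul, add_mul, sub_mul, mul_add, mul_sub,
    one_mul, mul_one, projA_mul_projA q h, projT_mul_projT q h, projA_mul_projT q h,
    projT_mul_projA q h]
  match_scalars <;> field_simp <;> ring

theorem inv_braid (h : 0 < q) : ((q : ℂ) • braid q)⁻¹ =
    ((q : ℂ) ^ 2)⁻¹ • projS q - projA q + (q : ℂ) • projT q :=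
  Matrix.inv_eq_right_inv (braid_mul q h)

/-- The relations of the coordinate algebra read `P_a x x = 0`. -/
theorem projA_x_x (h : 0 < q) (i j : Fin 3) :
    ∑ k, ∑ l, projA q (i, j) (k, l) • (x q k * x q l) = 0 := by
  have h0 : (q : ℂ) ≠ 0 := by exact_mod_cast h.ne'
  have he : ∀ c, ∑ k, ∑ l, eps q c k l • (x q k * x q l) = 0 := by
    intro c
    fin_cases c
    · simp only [eps, Fin.sum_univ_three]
      simp [-Complex.coe_smul, x_minus_zero]
    · simp only [eps, Fin.sum_univ_three]
      simp [-Complex.coe_smul, x_plus_zero, smul_smul, h0]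
    · simp only [eps, Fin.sum_univ_three]
      simp [-Complex.coe_smul, ← x_plus_minus]
      abel
  obtain ⟨w, hw⟩ : ∃ w : Fin 3 → ℂ, ∀ c, eps q c i j / ∑ m, ∑ n, eps q c m n ^ 2 = w c :=
    ⟨_, fun _ => rfl⟩
  have hP : ∀ k l, projA q (i, j) (k, l) • (x q k * x q l) = ∑ c,
      w c • (eps q c k l • (x q k * x q l)) := by
    intro k l
    rw [projA, Matrix.of_apply, Finset.sum_smul]
    refine Finset.sum_congr rfl fun c _ => ?_
    rw [smul_smul, ← hw]; congr 1; ring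
  calc _ = ∑ c, w c • ∑ k, ∑ l, eps q c k l • (x q k * x q l) := by
        simp only [hP, Fin.sum_univ_three, smul_add]; abel
    _ = 0 := by simp only [he, smul_zero, Finset.sum_const_zero]

set_option maxHeartbeats 4000000 in
/-- The entries of the inverse of `q R̂`, in terms of `s = √q`. -/
theorem inv_eq (h : 0 < q) : ((q : ℂ) • braid q)⁻¹ = pat ((sq q ^ 2)⁻¹ ^ 2) 0
    (((sq q ^ 2)⁻¹ - sq q ^ 2) * (sq q ^ 2)⁻¹) (sq q ^ 2)⁻¹ 0 0 (sq q ^ 2)⁻¹ 1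
    (-((sq q ^ 2)⁻¹ - sq q ^ 2) * (sq q)⁻¹)
    (((sq q ^ 2)⁻¹ - sq q ^ 2) * (1 - sq q ^ 2) * (sq q ^ 2)⁻¹) := by
  have h0 := sq_ne q h
  have h1 := den1 q h
  have h2 := den2 q h
  rw [inv_braid q h]
  ext ⟨i, j⟩ ⟨k, l⟩
  simp only [projS, projA, projT, Fin.sum_univ_three (fun c => _ / _), Matrix.add_apply,
    Matrix.sub_apply, Matrix.smul_apply, Matrix.of_apply, normG q h, smul_eq_mul, normE0 q h,
    normE1 q h, normE2 q h, pat]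
  fin_cases i <;> fin_cases j <;> fin_cases k <;> fin_cases l <;>
    first
    | (simp [eps, metric, hpar, sq_sq q h]; done)
    | (simp [eps, metric, hpar, sq_sq q h]; field_simp; done)
    | (simp [eps, metric, hpar, sq_sq q h]; field_simp; ring)

end BraidFacts

/-! ### The bimodule of one-forms -/

/-- The matrix `ρ(x^l)` with `ξ^k x^l = ρ(x^l)^k_j ξ^j`, obtained by solving the commutation
relations `x^i ξ^j = q R̂^{ij}_{kl} ξ^k x^l` for `ξ^k x^l`. -/
noncomputable def rhoX (q : ℝ) (l : Fin 3) : Matrix (Fin 3) (Fin 3) (Alg q) :=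
  .of fun k j => ∑ i, ((q : ℂ) • braid q)⁻¹ (k, l) (i, j) • x q i

section RhoFacts
variable (q : ℝ)

theorem rhoX_zero (h : 0 < q) : rhoX q 0 =
    !![((sq q ^ 2)⁻¹ ^ 2) • x q 0, 0, 0;
      (((sq q ^ 2)⁻¹ - sq q ^ 2) * (sq q ^ 2)⁻¹) • x q 1, (sq q ^ 2)⁻¹ • x q 0, 0;
      (((sq q ^ 2)⁻¹ - sq q ^ 2) * (1 - sq q ^ 2) * (sq q ^ 2)⁻¹) • x q 2,
      (-((sq q ^ 2)⁻¹ - sq q ^ 2) * (sq q)⁻¹) • x q 1, x q 0] := by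
  ext k j
  simp only [rhoX, inv_eq q h, Matrix.of_apply, Fin.sum_univ_three]
  fin_cases k <;> fin_cases j <;> simp [pat]

theorem rhoX_one (h : 0 < q) : rhoX q 1 =
    !![(sq q ^ 2)⁻¹ • x q 1, 0, 0;
      (-((sq q ^ 2)⁻¹ - sq q ^ 2) * (sq q)⁻¹) • x q 2, (sq q ^ 2)⁻¹ • x q 1, 0;
      0, (((sq q ^ 2)⁻¹ - sq q ^ 2) * (sq q ^ 2)⁻¹) • x q 2, (sq q ^ 2)⁻¹ • x q 1] := by
  ext k j
  simp only [rhoX, inv_eq q h, Matrix.of_apply, Fin.sum_univ_three]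
  fin_cases k <;> fin_cases j <;> simp [pat]

theorem rhoX_two (h : 0 < q) : rhoX q 2 =
    !![x q 2, 0, 0; 0, (sq q ^ 2)⁻¹ • x q 2, 0; 0, 0, ((sq q ^ 2)⁻¹ ^ 2) • x q 2] := by
  ext k j
  simp only [rhoX, inv_eq q h, Matrix.of_apply, Fin.sum_univ_three]
  fin_cases k <;> fin_cases j <;> simp [pat]

theorem n01 (h : 0 < q) : x q 0 * x q 1 = (sq q ^ 2) • (x q 1 * x q 0) := by
  rw [x_minus_zero, sq_sq q h]

theorem n21 (h : 0 < q) : x q 2 * x q 1 = (sq q ^ 2)⁻¹ • (x q 1 * x q 2) := by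
  rw [x_plus_zero, sq_sq q h]

theorem n20 : x q 2 * x q 0 = x q 0 * x q 2 + (sq q - (sq q)⁻¹) • (x q 1 * x q 1) := by
  rw [← sub_eq_iff_eq_add', x_plus_minus, hpar, one_div]

theorem rho_rel1 (h : 0 < q) : rhoX q 0 * rhoX q 1 = (q : ℂ) • (rhoX q 1 * rhoX q 0) := by
  have h0 := sq_ne q h
  rw [sq_sq q h, rhoX_zero q h, rhoX_one q h]
  ext k j
  fin_cases k <;> fin_cases j <;>
    simp [Matrix.mul_apply, Fin.sum_univ_three, smul_smul, n01 q h, n20 q, n21 q h]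
  all_goals try (match_scalars <;> field_simp <;> ring)

theorem rho_rel2 (h : 0 < q) : rhoX q 2 * rhoX q 1 = (q : ℂ)⁻¹ • (rhoX q 1 * rhoX q 2) := by
  have h0 := sq_ne q h
  rw [sq_sq q h, rhoX_two q h, rhoX_one q h]
  ext k j
  fin_cases k <;> fin_cases j <;>
    simp [Matrix.mul_apply, Fin.sum_univ_three, smul_smul, n01 q h, n20 q, n21 q h]
  all_goals try (match_scalars <;> field_simp <;> ring)

theorem rho_rel3 (h : 0 < q) : rhoX q 2 * rhoX q 0 - rhoX q 0 * rhoX q 2 =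
    hpar q • (rhoX q 1 * rhoX q 1) := by
  have h0 := sq_ne q h
  rw [hpar, rhoX_two q h, rhoX_one q h, rhoX_zero q h]
  ext k j
  fin_cases k <;> fin_cases j <;>
    simp [Matrix.mul_apply, Fin.sum_univ_three, smul_smul, n01 q h, n20 q, n21 q h]
  all_goals try (match_scalars <;> field_simp <;> ring)

set_option maxHeartbeats 1000000 in
theorem rho_r2 (h : 0 < q) : ∑ i, ∑ j, metric q i j • (rhoX q i * rhoX q j) =
    .diagonal fun _ => ((q : ℂ) ^ 2)⁻¹ • r2 q := by
  have h0 := sq_ne q h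
  have h3 : ∀ (B : Type) [Ring B] [Algebra ℂ B] (X : Fin 3 → B),
      ∑ i, ∑ j, metric q i j • (X i * X j) =
      (sq q)⁻¹ • (X 0 * X 2) + X 1 * X 1 + sq q • (X 2 * X 0) := by
    intro B _ _ X
    simp [metric, Fin.sum_univ_three]
  rw [h3, r2, h3, rhoX_two q h, rhoX_one q h, rhoX_zero q h, sq_sq q h]
  ext k j
  fin_cases k <;> fin_cases j <;>
    simp [Matrix.mul_apply, Fin.sum_univ_three, smul_smul, n01 q h, n20 q, n21 q h]
  all_goals try (match_scalars <;> field_simp <;> ring)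

end RhoFacts

/-- The bimodule `Ω¹` of one-forms: the free left module with basis `ξ⁻, ξ⁰, ξ⁺`, a one-form
`∑ f_i ξ^i` being given by its coefficients, with the right action determined by
`ξ^k f = ρ(f)^k_j ξ^j`, that is by `x^i ξ^j = q R̂^{ij}_{kl} ξ^k x^l`. -/
def OneForm (q : ℝ) : Type := Fin 3 → Alg q

noncomputable instance (q : ℝ) : AddCommGroup (OneForm q) :=
  inferInstanceAs (AddCommGroup (Fin 3 → Alg q))

noncomputable instance (q : ℝ) : Module (Alg q) (OneForm q) :=
  inferInstanceAs (Module (Alg q) (Fin 3 → Alg q))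

noncomputable instance (q : ℝ) : Module ℂ (OneForm q) :=
  inferInstanceAs (Module ℂ (Fin 3 → Alg q))

instance (q : ℝ) : IsScalarTower ℂ (Alg q) (OneForm q) :=
  inferInstanceAs (IsScalarTower ℂ (Alg q) (Fin 3 → Alg q))

/-- The basic one-forms `ξ^i = dx^i`. -/
noncomputable def xi (q : ℝ) (i : Fin 3) : OneForm q := (Pi.single i 1 : Fin 3 → Alg q)

/-- `x^i + dx^i` in the square-zero extension of the coordinate algebra by `Ω¹`. -/
noncomputable def extX (q : ℝ) (i : Fin 3) : TrivSqZeroExt (Alg q) (OneForm q) :=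
  TrivSqZeroExt.inl (x q i) + TrivSqZeroExt.inr (xi q i)

theorem fst_extX (q : ℝ) (i : Fin 3) : (extX q i).fst = x q i := by simp [extX]

theorem snd_extX (q : ℝ) (i : Fin 3) : (extX q i).snd = xi q i := by simp [extX]

section Forms
variable (q : ℝ) [hq : Fact (0 < q)]

/-- The homomorphism `ρ` from the coordinate algebra to `3 × 3` matrices over it with
`ξ^k f = ρ(f)^k_j ξ^j`. -/
noncomputable def rho : Alg q →ₐ[ℂ] Matrix (Fin 3) (Fin 3) (Alg q) :=
  liftAlg q (rhoX q) (.diagonal fun _ => (q : ℂ) ^ 2 • rinv2 q)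
    (rho_rel1 q hq.out) (rho_rel2 q hq.out) (rho_rel3 q hq.out)
    (by
      have h0 : (q : ℂ) ≠ 0 := by exact_mod_cast hq.out.ne'
      rw [rho_r2 q hq.out, Matrix.diagonal_mul_diagonal, ← Matrix.diagonal_one]
      congr 1; ext i
      rw [smul_mul_smul_comm, rinv2_mul_r2, mul_inv_cancel₀ (pow_ne_zero 2 h0), one_smul])
    (by
      have h0 : (q : ℂ) ≠ 0 := by exact_mod_cast hq.out.ne'
      rw [rho_r2 q hq.out, Matrix.diagonal_mul_diagonal, ← Matrix.diagonal_one]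
      congr 1; ext i
      rw [smul_mul_smul_comm, r2_mul_rinv2, inv_mul_cancel₀ (pow_ne_zero 2 h0), one_smul])

theorem rho_x (i : Fin 3) : rho q (x q i) = rhoX q i := liftAlg_x ..

theorem rho_rinv2 : rho q (rinv2 q) = .diagonal fun _ => (q : ℂ) ^ 2 • rinv2 q :=
  liftAlg_rinv2 ..

noncomputable instance : Module (Alg q)ᵐᵒᵖ (OneForm q) where
  smul b ω := (show Fin 3 → Alg q from ω) ᵥ* rho q b.unop
  one_smul ω := by
    change (show Fin 3 → Alg q from ω) ᵥ* rho q 1 = ω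
    rw [map_one, Matrix.vecMul_one]
  mul_smul b c ω := by
    change (show Fin 3 → Alg q from ω) ᵥ* rho q (c.unop * b.unop) =
      ((show Fin 3 → Alg q from ω) ᵥ* rho q c.unop) ᵥ* rho q b.unop
    rw [map_mul, Matrix.vecMul_vecMul]
  smul_zero _ := Matrix.zero_vecMul _
  smul_add _ _ _ := Matrix.add_vecMul _ _ _
  add_smul b c ω := by
    change (show Fin 3 → Alg q from ω) ᵥ* rho q (b.unop + c.unop) =
      (show Fin 3 → Alg q from ω) ᵥ* rho q b.unop + (show Fin 3 → Alg q from ω) ᵥ* rho q c.unop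
    rw [map_add, Matrix.vecMul_add]
  zero_smul ω := by
    change (show Fin 3 → Alg q from ω) ᵥ* rho q 0 = 0
    rw [map_zero, Matrix.vecMul_zero]

theorem op_smul_def (ω : OneForm q) (f : Alg q) :
    ω <• f = (show Fin 3 → Alg q from ω) ᵥ* rho q f := rfl

instance : SMulCommClass (Alg q) (Alg q)ᵐᵒᵖ (OneForm q) where
  smul_comm a b ω := (Matrix.smul_vecMul a _ _).symm

instance : IsScalarTower ℂ (Alg q)ᵐᵒᵖ (OneForm q) where
  smul_assoc c b ω := by
    change (show Fin 3 → Alg q from ω) ᵥ* rho q (c • b.unop) =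
      c • ((show Fin 3 → Alg q from ω) ᵥ* rho q b.unop)
    rw [map_smul, Matrix.vecMul_smul]

theorem xi_op_smul (k : Fin 3) (f : Alg q) : xi q k <• f = ∑ j, rho q f k j • xi q j := by
  rw [op_smul_def]
  funext j
  change ((Pi.single k 1 : Fin 3 → Alg q) ᵥ* rho q f) j = _
  rw [Matrix.single_one_vecMul]
  have : (∑ j, rho q f k j • xi q j : OneForm q) =
      (∑ j, rho q f k j • (Pi.single j 1 : Fin 3 → Alg q)) := rfl
  rw [this]
  simp [Pi.single_apply]

/-- The commutation relations `x^i ξ^j = q R̂^{ij}_{kl} ξ^k x^l`. -/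
theorem x_smul_xi (i j : Fin 3) : x q i • xi q j =
    ∑ k, ∑ l, ((q : ℂ) • braid q) (i, j) (k, l) • (xi q k <• x q l) := by
  have hu : ((q : ℂ) • braid q) * ((q : ℂ) • braid q)⁻¹ = 1 := by
    rw [inv_braid q hq.out, braid_mul q hq.out]
  generalize hM : (q : ℂ) • braid q = M at *
  have h1 : ∀ k l, xi q k <• x q l =
      ∑ n, ∑ m, M⁻¹ (k, l) (m, n) • (x q m • xi q n) := by
    intro k l
    rw [xi_op_smul, rho_x, rhoX, hM]
    simp only [Matrix.of_apply, Finset.sum_smul, smul_assoc]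
  simp only [h1, Finset.smul_sum, smul_smul]
  have h2 : ∀ m n, ∑ k, ∑ l, M (i, j) (k, l) * M⁻¹ (k, l) (m, n) =
      if (i, j) = (m, n) then 1 else 0 := by
    intro m n
    rw [← Fintype.sum_prod_type (fun p => M (i, j) p * M⁻¹ p (m, n)), ← Matrix.mul_apply, hu,
      Matrix.one_apply]
  calc x q i • xi q j = ∑ n, ∑ m, (∑ k, ∑ l, M (i, j) (k, l) * M⁻¹ (k, l) (m, n)) •
        (x q m • xi q n) := by
        simp only [h2, Prod.mk.injEq, ite_and, ite_smul, one_smul, zero_smul]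
        simp
    _ = _ := by
        simp only [Finset.sum_smul]
        simp only [Fin.sum_univ_three]
        abel

/-! ### The differential -/

theorem xi_op_smul_x (k l : Fin 3) : xi q k <• x q l =
    ∑ j, ∑ i, ((q : ℂ) • braid q)⁻¹ (k, l) (i, j) • (x q i • xi q j) := by
  rw [xi_op_smul, rho_x, rhoX]
  simp only [Matrix.of_apply, Finset.sum_smul, smul_assoc]

set_option maxHeartbeats 1000000 in
theorem d_rel1 : x q 0 • xi q 1 + xi q 0 <• x q 1 =
    (q : ℂ) • (x q 1 • xi q 0 + xi q 1 <• x q 0) := by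
  have h0 := sq_ne q hq.out
  simp only [xi_op_smul_x, inv_eq q hq.out]
  rw [sq_sq q hq.out]
  obtain ⟨y, hy⟩ : ∃ y : Fin 3 → Fin 3 → OneForm q, ∀ i j, x q i • xi q j = y i j :=
    ⟨_, fun _ _ => rfl⟩
  simp only [hy, Fin.sum_univ_three]
  simp [pat]
  match_scalars <;> field_simp <;> ring

set_option maxHeartbeats 1000000 in
theorem d_rel2 : x q 2 • xi q 1 + xi q 2 <• x q 1 =
    (q : ℂ)⁻¹ • (x q 1 • xi q 2 + xi q 1 <• x q 2) := by
  have h0 := sq_ne q hq.out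
  simp only [xi_op_smul_x, inv_eq q hq.out]
  rw [sq_sq q hq.out]
  obtain ⟨y, hy⟩ : ∃ y : Fin 3 → Fin 3 → OneForm q, ∀ i j, x q i • xi q j = y i j :=
    ⟨_, fun _ _ => rfl⟩
  simp only [hy, Fin.sum_univ_three]
  simp [pat]
  match_scalars <;> field_simp <;> ring

set_option maxHeartbeats 1000000 in
theorem d_rel3 : x q 2 • xi q 0 + xi q 2 <• x q 0 - (x q 0 • xi q 2 + xi q 0 <• x q 2) =
    hpar q • (x q 1 • xi q 1 + xi q 1 <• x q 1) := by
  have h0 := sq_ne q hq.out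
  simp only [xi_op_smul_x, inv_eq q hq.out, hpar]
  obtain ⟨y, hy⟩ : ∃ y : Fin 3 → Fin 3 → OneForm q, ∀ i j, x q i • xi q j = y i j :=
    ⟨_, fun _ _ => rfl⟩
  simp only [hy, Fin.sum_univ_three]
  simp [pat]
  match_scalars <;> field_simp <;> ring

/-- `d(r²)`, as `g_{ij} (x^i ξ^j + ξ^i x^j)`. -/
noncomputable def dr2 : OneForm q :=
  ∑ i, ∑ j, metric q i j • (x q i • xi q j + xi q i <• x q j)

open TrivSqZeroExt

theorem ext_r2 : ∑ i, ∑ j, metric q i j • (extX q i * extX q j) = inl (r2 q) + inr (dr2 q) := by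
  ext <;> simp [r2, dr2, fst_extX, snd_extX, fst_sum, snd_sum]

/-- The algebra homomorphism `f ↦ f + df` to the square-zero extension by `Ω¹`, with
`dx^i = ξ^i` and `d(r⁻²) = - r⁻² d(r²) r⁻²`. -/
noncomputable def dHom : Alg q →ₐ[ℂ] TrivSqZeroExt (Alg q) (OneForm q) :=
  liftAlg q (extX q) (inl (rinv2 q) - inr (rinv2 q • (dr2 q <• rinv2 q)))
    (by
      ext
      · simpa only [fst_mul, fst_smul, fst_extX] using x_minus_zero q
      · simpa only [snd_mul, snd_smul, fst_extX, snd_extX] using d_rel1 q)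
    (by
      ext
      · simpa only [fst_mul, fst_smul, fst_extX] using x_plus_zero q
      · simpa only [snd_mul, snd_smul, fst_extX, snd_extX] using d_rel2 q)
    (by
      ext
      · simpa only [fst_mul, fst_smul, fst_sub, fst_extX] using x_plus_minus q
      · simpa only [snd_mul, snd_smul, snd_sub, fst_extX, snd_extX] using d_rel3 q)
    (by
      rw [ext_r2]
      ext
      · simp [rinv2_mul_r2]
      · simp only [snd_mul, fst_sub, fst_add, fst_inl, fst_inr, snd_sub, snd_add, snd_inl, snd_inr,
          sub_zero, zero_sub, zero_add, add_zero, smul_neg, snd_one]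
        rw [← smul_comm (rinv2 q), ← mul_smul (MulOpposite.op _), ← MulOpposite.op_mul,
          rinv2_mul_r2, MulOpposite.op_one, one_smul, add_neg_cancel])
    (by
      rw [ext_r2]
      ext
      · simp [r2_mul_rinv2]
      · simp only [snd_mul, fst_sub, fst_add, fst_inl, fst_inr, snd_sub, snd_add, snd_inl, snd_inr,
          sub_zero, zero_sub, zero_add, add_zero, smul_neg, snd_one]
        rw [← mul_smul, r2_mul_rinv2, one_smul, neg_add_cancel])

theorem fst_dHom (f : Alg q) : (dHom q f).fst = f := by
  have h : (fstHom ℂ (Alg q) (OneForm q)).comp (dHom q) = AlgHom.id ℂ (Alg q) := by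
    refine hom_ext_alg q (fun i => ?_) ?_
    · rw [AlgHom.comp_apply, dHom, liftAlg_x, fstHom_apply, fst_extX]; rfl
    · rw [AlgHom.comp_apply, dHom, liftAlg_rinv2]; simp
  exact DFunLike.congr_fun h f

/-- The exterior derivative `d : A → Ω¹`. -/
noncomputable def d : Alg q →+ OneForm q :=
  AddMonoidHom.mk' (fun f => (dHom q f).snd) (by intro f g; simp)

theorem d_x (i : Fin 3) : d q (x q i) = xi q i := by
  change (dHom q (x q i)).snd = _
  rw [dHom, liftAlg_x, snd_extX]

/-- The Leibniz rule. -/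
theorem d_mul (f g : Alg q) : d q (f * g) = f • d q g + d q f <• g := by
  change (dHom q (f * g)).snd = f • (dHom q g).snd + (dHom q f).snd <• g
  rw [map_mul, snd_mul, fst_dHom, fst_dHom]

theorem d_algebraMap (c : ℂ) : d q (algebraMap ℂ (Alg q) c) = 0 := by
  change (dHom q (algebraMap ℂ (Alg q) c)).snd = 0
  rw [AlgHom.commutes]; rfl

/-! ### Two-forms, the Dirac operator and the connections -/

/-- The relations `P_s ξ ξ = 0` and `P_t ξ ξ = 0` of two-forms. -/
def twoFormRel : Set (BTensor (Alg q) (OneForm q) (OneForm q)) :=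
  {t | ∃ P, (P = projS q ∨ P = projT q) ∧ ∃ i j, t = ∑ k, ∑ l,
    algebraMap ℂ (Alg q) (P (i, j) (k, l)) • BTensor.tmul (Alg q) (xi q k) (xi q l)}

/-- The bimodule `Ω²` of two-forms: the quotient of `Ω¹ ⊗_A Ω¹` by the relations
`P_s ξ ξ = 0` and `P_t ξ ξ = 0`. -/
abbrev TwoForm : Type := QuotBimodule (Alg q) (twoFormRel q)

/-- The projection `π : Ω¹ ⊗_A Ω¹ → Ω²`. -/
noncomputable def wedge : BTensor (Alg q) (OneForm q) (OneForm q) →+ TwoForm q :=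
  (QuotBimodule.proj (A := Alg q) (twoFormRel q)).toAddMonoidHom

theorem wedge_right (t : BTensor (Alg q) (OneForm q) (OneForm q)) (a : Alg q) :
    wedge q (t <• a) = wedge q t <• a := rfl

/-- The Dirac operator `θ = (q - 1)⁻¹ q² r⁻² x^i ξ^j g_{ij}`. -/
noncomputable def dirac (q : ℝ) : OneForm q :=
  (((q : ℂ) - 1)⁻¹ * (q : ℂ) ^ 2) • rinv2 q • ∑ i, ∑ j, metric q i j • (x q i • xi q j)

/-- The linear connection `C` is `D_(0)` for the matrix `S`: its generalized flip `σ₀` is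
determined by `σ₀ (ξ^i ⊗ ξ^j) = S^{ij}_{hk} ξ^h ⊗ ξ^k`, and
`D_(0) ξ = -θ ⊗ ξ + σ₀ (ξ ⊗ θ)`. -/
def IsD0 (S : Matrix (Fin 3 × Fin 3) (Fin 3 × Fin 3) ℂ) (C : LinearConnection (d q)) : Prop :=
  (∀ i j, C.σ (BTensor.tmul (Alg q) (xi q i) (xi q j)) = ∑ h, ∑ k,
    algebraMap ℂ (Alg q) (S (i, j) (h, k)) • BTensor.tmul (Alg q) (xi q h) (xi q k)) ∧
  ∀ ω, C.D ω = -BTensor.tmul (Alg q) (dirac q) ω + C.σ (BTensor.tmul (Alg q) ω (dirac q))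

end Forms

end QEuclid

/-!
The generalized flip is determined by the matrix `S`, because `Ω¹ ⊗_A Ω¹` is free as a left
module on the tensors `ξ^i ⊗ ξ^j`; with it `D_(0)` is determined, whence uniqueness. For existence,
`matrixMap` turns any matrix into a left linear map. Moving a coordinate across `ξ^i ⊗ ξ^j` is done
by two copies of `(q R̂)⁻¹`, so the right linearity of the flip of `(q R̂)⁻¹` is the braid equation
`inv_braid_yangBaxter`, an identity between explicit sparse matrices; the flip of `q R̂` is the
inverse map, hence right linear as well. The formula for `D_(0)` obeys both Leibniz rules because
the differential is inner, `df = f θ - θ f` (`d_eq`), which reduces to the commutator of the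
coordinates with the one-form `g_{ij} x^i ξ^j`.

Flatness follows from three facts about `σ` (`LinearConnection.curvature_eq_zero_of_braid`):

* `σ` satisfies the braid equation on `Ω¹ ⊗_A Ω¹ ⊗_A Ω¹`;
* `π ∘ σ = -π`, since `S` is `-1` on the image of `P_a`, the part that survives in `Ω²`;
* `θ ⊗ θ` is in the image of `1 + σ`, that is `P_a (θ ⊗ θ) = 0`.

The last one holds because `g_{ij} x^i ξ^j` commutes with the coordinates up to multiples of
`r² ξ^k`: its tensor square consists of a term with coefficients `x x`, which `P_a` kills by the
relations of the algebra, and of a multiple of the metric tensor, which is orthogonal to the image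
of `P_a`.
-/

/-! ### Associativity of the tensor product of bimodules -/

namespace BTensor

section Sums

variable {A M N : Type*} [Ring A] [AddCommGroup M] [Module Aᵐᵒᵖ M] [AddCommGroup N] [Module A N]

theorem sum_tmul {ι : Type*} (s : Finset ι) (f : ι → M) (n : N) :
    tmul A (∑ i ∈ s, f i) n = ∑ i ∈ s, tmul A (f i) n :=
  map_sum ((mk A M N).flip n) f s

theorem tmul_sum {ι : Type*} (s : Finset ι) (m : M) (f : ι → N) :
    tmul A m (∑ i ∈ s, f i) = ∑ i ∈ s, tmul A m (f i) :=
  map_sum (mk A M N m) f s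

theorem neg_tmul (m : M) (n : N) : tmul A (-m) n = -tmul A m n :=
  map_neg ((mk A M N).flip n) m

theorem tmul_neg (m : M) (n : N) : tmul A m (-n) = -tmul A m n :=
  map_neg (mk A M N m) n

theorem sub_tmul (m m' : M) (n : N) : tmul A (m - m') n = tmul A m n - tmul A m' n :=
  map_sub ((mk A M N).flip n) m m'

end Sums

section Assoc

variable {A L M N : Type*} [Ring A] [AddCommGroup L] [Module Aᵐᵒᵖ L]
  [AddCommGroup M] [Module A M] [Module Aᵐᵒᵖ M] [SMulCommClass A Aᵐᵒᵖ M]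
  [AddCommGroup N] [Module A N]

/-- The associativity map `(L ⊗_A M) ⊗_A N → L ⊗_A (M ⊗_A N)`, `(l ⊗ m) ⊗ n ↦ l ⊗ (m ⊗ n)`,
inverse to `assocInv`. -/
def assoc (A L M N : Type*) [Ring A] [AddCommGroup L] [Module Aᵐᵒᵖ L]
    [AddCommGroup M] [Module A M] [Module Aᵐᵒᵖ M] [SMulCommClass A Aᵐᵒᵖ M]
    [AddCommGroup N] [Module A N] :
    BTensor A (BTensor A L M) N →+ BTensor A L (BTensor A M N) :=
  lift (AddMonoidHom.flip (AddMonoidHom.mk'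
    (fun n => map (A := A) (AddMonoidHom.id L) (fun _ _ => rfl) ((mk A M N).flip n)
      (fun _ _ => rfl))
    (fun n n' => hom_ext (fun l m => by
      change tmul A l (tmul A m (n + n')) = tmul A l (tmul A m n) + tmul A l (tmul A m n')
      rw [tmul_add, tmul_add])))) (by
      intro t a n
      induction t using BTensor.induction with
      | h0 => simp
      | ht l m =>
        change tmul A l (tmul A (m <• a) n) = tmul A l (tmul A m (a • n))
        rw [smul_tmul]
      | ha s t hs ht => simp only [smul_add, map_add, AddMonoidHom.add_apply, hs, ht])

@[simp] theorem assoc_tmul (l : L) (m : M) (n : N) :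
    assoc A L M N (tmul A (tmul A l m) n) = tmul A l (tmul A m n) := rfl

theorem assocInv_tmul' (l : L) (m : M) (n : N) :
    assocInv A L M N (tmul A l (tmul A m n)) = tmul A (tmul A l m) n := rfl

theorem assoc_assocInv (t : BTensor A L (BTensor A M N)) :
    assoc A L M N (assocInv A L M N t) = t := by
  have : (assoc A L M N).comp (assocInv A L M N) = AddMonoidHom.id _ := by
    refine hom_ext fun l t => ?_
    induction t using BTensor.induction with
    | h0 => simp [tmul_zero]
    | ht m n => rfl
    | ha s t hs ht => rw [tmul_add, map_add, map_add, hs, ht]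
  exact DFunLike.congr_fun this t

theorem assocInv_assoc (t : BTensor A (BTensor A L M) N) :
    assocInv A L M N (assoc A L M N t) = t := by
  have : (assocInv A L M N).comp (assoc A L M N) = AddMonoidHom.id _ := by
    refine hom_ext fun t n => ?_
    induction t using BTensor.induction with
    | h0 => simp [zero_tmul]
    | ht l m => rfl
    | ha s t hs ht => rw [add_tmul, map_add, map_add, hs, ht]
  exact DFunLike.congr_fun this t

end Assoc

/-! ### The two legs of a flip on the triple tensor product -/

section Legs

variable {A Ω : Type*} [Ring A] [AddCommGroup Ω] [Module A Ω] [Module Aᵐᵒᵖ Ω]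
  [SMulCommClass A Aᵐᵒᵖ Ω]

/-- `σ ⊗ 1` on `(Ω ⊗_A Ω) ⊗_A Ω`. -/
def leg12 (σ : BTensor A Ω Ω →+ BTensor A Ω Ω) (hr : ∀ t (a : A), σ (t <• a) = σ t <• a) :
    BTensor A (BTensor A Ω Ω) Ω →+ BTensor A (BTensor A Ω Ω) Ω :=
  map σ hr (AddMonoidHom.id Ω) (fun _ _ => rfl)

/-- `1 ⊗ σ`, transported to `(Ω ⊗_A Ω) ⊗_A Ω`. -/
def leg23 (σ : BTensor A Ω Ω →+ BTensor A Ω Ω) (hl : ∀ (a : A) t, σ (a • t) = a • σ t) :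
    BTensor A (BTensor A Ω Ω) Ω →+ BTensor A (BTensor A Ω Ω) Ω :=
  ((assocInv A Ω Ω Ω).comp (map (AddMonoidHom.id Ω) (fun _ _ => rfl) σ hl)).comp (assoc A Ω Ω Ω)

variable {σ τ : BTensor A Ω Ω →+ BTensor A Ω Ω} {hr : ∀ t (a : A), σ (t <• a) = σ t <• a}
  {hr' : ∀ t (a : A), τ (t <• a) = τ t <• a} {hl : ∀ (a : A) t, σ (a • t) = a • σ t}
  {hl' : ∀ (a : A) t, τ (a • t) = a • τ t}

theorem leg12_tmul (t : BTensor A Ω Ω) (ω : Ω) :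
    leg12 σ hr (tmul A t ω) = tmul A (σ t) ω := rfl

theorem leg23_assocInv_tmul (ω : Ω) (t : BTensor A Ω Ω) :
    leg23 σ hl (assocInv A Ω Ω Ω (tmul A ω t)) = assocInv A Ω Ω Ω (tmul A ω (σ t)) := by
  change assocInv A Ω Ω Ω (map _ _ _ _ (assoc A Ω Ω Ω (assocInv A Ω Ω Ω (tmul A ω t)))) = _
  rw [assoc_assocInv]; rfl

theorem leg23_tmul (ω η ζ : Ω) :
    leg23 σ hl (tmul A (tmul A ω η) ζ) = assocInv A Ω Ω Ω (tmul A ω (σ (tmul A η ζ))) :=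
  rfl

theorem leg12_leg12 (h : ∀ t, σ (τ t) = t) (t : BTensor A (BTensor A Ω Ω) Ω) :
    leg12 σ hr (leg12 τ hr' t) = t := by
  induction t using BTensor.induction with
  | h0 => simp
  | ht t ω => rw [leg12_tmul, leg12_tmul, h]
  | ha s t hs ht => simp only [map_add, hs, ht]

theorem leg23_leg23 (h : ∀ t, σ (τ t) = t) (t : BTensor A (BTensor A Ω Ω) Ω) :
    leg23 σ hl (leg23 τ hl' t) = t := by
  rw [← assocInv_assoc t]
  induction assoc A Ω Ω Ω t using BTensor.induction with
  | h0 => simp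
  | ht ω t => rw [leg23_assocInv_tmul, leg23_assocInv_tmul, h]
  | ha s t hs ht => simp only [map_add, hs, ht]

theorem leg12_smul (a : A) (t : BTensor A (BTensor A Ω Ω) Ω)
    (hl : ∀ (a : A) t, σ (a • t) = a • σ t) : leg12 σ hr (a • t) = a • leg12 σ hr t := by
  induction t using BTensor.induction with
  | h0 => simp
  | ht s ω => rw [left_smul_tmul, leg12_tmul, leg12_tmul, hl, left_smul_tmul]
  | ha s t hs ht => simp only [smul_add, map_add, hs, ht]

theorem assocInv_smul (a : A) (t : BTensor A Ω (BTensor A Ω Ω)) :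
    assocInv A Ω Ω Ω (a • t) = a • assocInv A Ω Ω Ω t := by
  induction t using BTensor.induction with
  | h0 => simp
  | ht ω t =>
    induction t using BTensor.induction with
    | h0 => simp [tmul_zero]
    | ht η ζ => rfl
    | ha s t hs ht => simp only [tmul_add, smul_add, map_add, hs, ht]
  | ha s t hs ht => simp only [smul_add, map_add, hs, ht]

theorem leg23_smul (a : A) (t : BTensor A (BTensor A Ω Ω) Ω) :
    leg23 σ hl (a • t) = a • leg23 σ hl t := by
  rw [← assocInv_assoc t]
  induction assoc A Ω Ω Ω t using BTensor.induction with
  | h0 => simp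
  | ht ω t =>
    rw [leg23_assocInv_tmul, ← assocInv_smul, ← assocInv_smul, left_smul_tmul, left_smul_tmul,
      leg23_assocInv_tmul]
  | ha s t hs ht => simp only [smul_add, map_add, hs, ht]

end Legs

end BTensor

/-! ### A criterion for flatness -/

namespace LinearConnection

open BTensor

variable {A Ω Ω₂ : Type*} [Ring A] [AddCommGroup Ω] [Module A Ω] [Module Aᵐᵒᵖ Ω]
  [SMulCommClass A Aᵐᵒᵖ Ω] [AddCommGroup Ω₂] [Module Aᵐᵒᵖ Ω₂]

/-- A connection `D ω = -θ ⊗ ω + σ (ω ⊗ θ)` is flat as soon as `σ` satisfies the braid equation,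
`π ∘ σ = -π` and `θ ⊗ θ` lies in the image of `1 + σ`. Here `D₂ t = -θ ⊗ t + σ₁₂ σ₂₃ (t ⊗ θ)`, so
the curvature of `ω` is
`π₁₂ (θ ⊗ θ ⊗ ω) + π₁₂ σ₂₃ (θ ⊗ ω ⊗ θ) - π₁₂ (θ ⊗ σ (ω ⊗ θ)) - π₁₂ σ₂₃ σ₁₂ (ω ⊗ θ ⊗ θ)`, in which
the first and the last term vanish and the other two cancel. -/
theorem curvature_eq_zero_of_braid {d : A →+ Ω} (C : LinearConnection d)
    (π : BTensor A Ω Ω →+ Ω₂) (hπ : ∀ t (a : A), π (t <• a) = π t <• a) (θ : Ω)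
    (hD : ∀ ω, C.D ω = -tmul A θ ω + C.σ (tmul A ω θ))
    (hb : ∀ t, leg12 C.σ C.σ_right (leg23 C.σ C.σ_left (leg12 C.σ C.σ_right t)) =
      leg23 C.σ C.σ_left (leg12 C.σ C.σ_right (leg23 C.σ C.σ_left t)))
    (hσ : ∀ t, π (C.σ t) = -π t) {t₀ : BTensor A Ω Ω} (hθ : tmul A θ θ = t₀ + C.σ t₀) :
    C.curvature π hπ = 0 := by
  set π12 := BTensor.map π hπ (AddMonoidHom.id Ω) (fun _ _ => rfl)
  set s12 := leg12 C.σ C.σ_right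
  set s23 := leg23 C.σ C.σ_left
  have h12 : ∀ t, π12 (s12 t) = -π12 t := by
    intro t
    induction t using BTensor.induction with
    | h0 => simp
    | ht t ω =>
      change tmul A (π (C.σ t)) ω = -tmul A (π t) ω
      rw [hσ]
      exact map_neg ((BTensor.mk A Ω₂ Ω).flip ω) _
    | ha s t hs ht => rw [map_add, map_add, map_add, hs, ht, neg_add]
  have hD₂ : ∀ t, C.D₂ t = -assocInv A Ω Ω Ω (tmul A θ t) + s12 (s23 (tmul A t θ)) := by
    intro t
    induction t using BTensor.induction with
    | h0 => simp [tmul_zero, zero_tmul]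
    | ht ω η =>
      rw [C.D₂_tmul, hD, hD, tmul_add, map_add, map_add, tmul_neg, map_neg, map_neg, add_tmul,
        neg_tmul, leg23_tmul]
      change -tmul A (tmul A θ ω) η + tmul A (C.σ (tmul A ω θ)) η +
        (-tmul A (C.σ (tmul A ω θ)) η + s12 _) = _
      rw [assocInv_tmul']
      abel
    | ha s t hs ht => rw [map_add, hs, ht, tmul_add, add_tmul]; simp only [map_add]; abel
  ext ω
  change π12 (C.D₂ (C.D ω)) = 0
  have hπθ : π (tmul A θ θ) = 0 := by rw [hθ, map_add, hσ, add_neg_cancel]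
  have hlast : π12 (s12 (s23 (tmul A (C.σ (tmul A ω θ)) θ))) = 0 := by
    -- `θ ⊗ θ = (1 + σ) t₀`, and `σ₂₃ σ₁₂ (1 + σ₂₃) = (1 + σ₁₂) σ₂₃ σ₁₂` is killed by `π₁₂`.
    have h1 : tmul A (C.σ (tmul A ω θ)) θ =
        s12 (assocInv A Ω Ω Ω (tmul A ω t₀) + s23 (assocInv A Ω Ω Ω (tmul A ω t₀))) := by
      rw [leg23_assocInv_tmul, ← map_add, ← tmul_add, ← hθ, assocInv_tmul', leg12_tmul]
    rw [h1, h12]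
    generalize assocInv A Ω Ω Ω (tmul A ω t₀) = u
    rw [map_add, map_add, ← hb, map_add, h12, add_neg_cancel, neg_zero]
  rw [hD, hD₂, tmul_add, add_tmul]
  simp only [map_add, map_neg, tmul_neg, neg_tmul, hlast]
  rw [h12, leg23_tmul, assocInv_tmul']
  have h0 : π12 (tmul A (tmul A θ θ) ω) = 0 := by
    change tmul A (π (tmul A θ θ)) ω = 0
    rw [hπθ, zero_tmul]
  rw [h0]
  abel

end LinearConnection

namespace QEuclid

open Matrix BTensor

/-! ### The braid equation -/

set_option maxHeartbeats 2000000 in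
/-- The nonzero entries of each row of `(q R̂)⁻¹`. -/
theorem sum_inv_braid {q : ℝ} (h : 0 < q) {V : Type*} [AddCommGroup V] [Module ℂ V]
    (i j : Fin 3) (f : Fin 3 → Fin 3 → V) :
    ∑ k, ∑ l, ((q : ℂ) • braid q)⁻¹ (i, j) (k, l) • f k l =
      ![![((sq q ^ 2)⁻¹ ^ 2) • f 0 0, (sq q ^ 2)⁻¹ • f 1 0, f 2 0],
        ![(((sq q ^ 2)⁻¹ - sq q ^ 2) * (sq q ^ 2)⁻¹) • f 1 0 + (sq q ^ 2)⁻¹ • f 0 1,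
          (sq q ^ 2)⁻¹ • f 1 1 + (-((sq q ^ 2)⁻¹ - sq q ^ 2) * (sq q)⁻¹) • f 2 0,
          (sq q ^ 2)⁻¹ • f 2 1],
        ![f 0 2 + (-((sq q ^ 2)⁻¹ - sq q ^ 2) * (sq q)⁻¹) • f 1 1 +
            (((sq q ^ 2)⁻¹ - sq q ^ 2) * (1 - sq q ^ 2) * (sq q ^ 2)⁻¹) • f 2 0,
          (((sq q ^ 2)⁻¹ - sq q ^ 2) * (sq q ^ 2)⁻¹) • f 2 1 + (sq q ^ 2)⁻¹ • f 1 2,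
          ((sq q ^ 2)⁻¹ ^ 2) • f 2 2]] i j := by
  rw [inv_eq q h]
  fin_cases i <;> fin_cases j <;> simp [pat, Fin.sum_univ_three] <;> abel

set_option maxHeartbeats 4000000 in
/-- The braid equation for `(q R̂)⁻¹`, applied to a family of vectors `y` rather than stated for
`27 × 27` matrices, so that `sum_inv_braid` keeps only the nonzero terms. It serves both the right
linearity of the generalized flip and the braid equation on `Ω¹ ⊗_A Ω¹ ⊗_A Ω¹`. -/
theorem inv_braid_yangBaxter {q : ℝ} (h : 0 < q) {V : Type*} [AddCommGroup V] [Module ℂ V]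
    (y : Fin 3 → Fin 3 → Fin 3 → V) (i j l : Fin 3) :
    ∑ a, ∑ b, ((q : ℂ) • braid q)⁻¹ (j, l) (a, b) •
      ∑ c, ∑ d, ((q : ℂ) • braid q)⁻¹ (i, a) (c, d) •
        ∑ e, ∑ f, ((q : ℂ) • braid q)⁻¹ (d, b) (e, f) • y c e f =
    ∑ a, ∑ b, ((q : ℂ) • braid q)⁻¹ (i, j) (a, b) •
      ∑ c, ∑ f, ((q : ℂ) • braid q)⁻¹ (b, l) (c, f) •
        ∑ d, ∑ e, ((q : ℂ) • braid q)⁻¹ (a, c) (d, e) • y d e f := by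
  have h0 := sq_ne q h
  simp only [sum_inv_braid h]
  fin_cases i <;> fin_cases j <;> fin_cases l <;> simp <;>
    (match_scalars <;> field_simp <;> ring)

/-! ### The differential is inner -/

/-- Induction on the generators `x^i`, `r⁻²` of the coordinate algebra. -/
theorem alg_induction (q : ℝ) {p : Alg q → Prop} (hc : ∀ c, p (algebraMap ℂ (Alg q) c))
    (hx : ∀ i, p (x q i)) (hr : p (rinv2 q)) (hm : ∀ a b, p a → p b → p (a * b))
    (ha : ∀ a b, p a → p b → p (a + b)) (f : Alg q) : p f := by
  obtain ⟨f, rfl⟩ : ∃ t, mkAlg q t = f := RingQuot.mkAlgHom_surjective ℂ (Rel q) f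
  induction f using FreeAlgebra.induction with
  | grade0 c => rw [AlgHom.commutes]; exact hc c
  | grade1 g =>
    cases g with
    | x i => exact hx i
    | rinv => exact hr
  | mul a b h1 h2 => rw [map_mul]; exact hm _ _ h1 h2
  | add a b h1 h2 => rw [map_add]; exact ha _ _ h1 h2

section Centre

variable (q : ℝ)

theorem r2_eq : r2 q = (sq q)⁻¹ • (x q 0 * x q 2) + x q 1 * x q 1 + sq q • (x q 2 * x q 0) := by
  simp [r2, metric, Fin.sum_univ_three]

/-- `r²` is central: both sides are brought to the order `x⁰, x⁻, x⁺` of the factors. -/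
theorem x_mul_r2 (h : 0 < q) (i : Fin 3) : x q i * r2 q = r2 q * x q i := by
  have h0 := sq_ne q h
  have a01 : ∀ t, x q 0 * (x q 1 * t) = (sq q ^ 2) • (x q 1 * (x q 0 * t)) := fun t => by
    rw [← mul_assoc, n01 q h, smul_mul_assoc, mul_assoc]
  have a21 : ∀ t, x q 2 * (x q 1 * t) = (sq q ^ 2)⁻¹ • (x q 1 * (x q 2 * t)) := fun t => by
    rw [← mul_assoc, n21 q h, smul_mul_assoc, mul_assoc]
  have a20 : ∀ t, x q 2 * (x q 0 * t) = x q 0 * (x q 2 * t) +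
      (sq q - (sq q)⁻¹) • (x q 1 * (x q 1 * t)) := fun t => by
    rw [← mul_assoc, n20 q, add_mul, smul_mul_assoc, mul_assoc, mul_assoc]
  rw [r2_eq]
  fin_cases i <;>
    simp [mul_add, add_mul, mul_assoc, smul_smul, n01 q h, n20 q, n21 q h, a01, a21, a20] <;>
    (match_scalars <;> field_simp <;> ring)

theorem x_mul_rinv2 (h : 0 < q) (i : Fin 3) : x q i * rinv2 q = rinv2 q * x q i := by
  calc x q i * rinv2 q = rinv2 q * (r2 q * x q i) * rinv2 q := by
        rw [← mul_assoc, rinv2_mul_r2, one_mul]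
    _ = rinv2 q * x q i := by
        rw [← x_mul_r2 q h, mul_assoc, mul_assoc, r2_mul_rinv2, mul_one]

end Centre

section Euler

variable (q : ℝ)


/-- The one-form `g_{ij} x^i ξ^j`, of which the Dirac operator is a multiple. -/
noncomputable def euler (q : ℝ) : OneForm q := ∑ i, ∑ j, metric q i j • (x q i • xi q j)

/-- The coefficients `g_{ij} x^i` of `euler q`. -/
noncomputable def eulerCoeff (q : ℝ) : Fin 3 → Alg q :=
  ![sq q • x q 2, x q 1, (sq q)⁻¹ • x q 0]

theorem sum_smul_xi (f : Fin 3 → Alg q) : (∑ i, f i • xi q i : OneForm q) = f := by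
  change ∑ i, f i • (Pi.single i 1 : Fin 3 → Alg q) = f
  funext j
  simp [Pi.single_apply]

theorem oneForm_eq_sum (ω : OneForm q) : ω = ∑ i, (show Fin 3 → Alg q from ω) i • xi q i :=
  (sum_smul_xi q _).symm

theorem eulerCoeff_eq_sum (k : Fin 3) : eulerCoeff q k = ∑ m, metric q m k • x q m := by
  fin_cases k <;> simp [eulerCoeff, metric, Fin.sum_univ_three]

theorem euler_eq_sum : euler q = ∑ j, eulerCoeff q j • xi q j := by
  simp [euler, eulerCoeff, metric, Fin.sum_univ_three, smul_assoc]
  abel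

theorem euler_eq : euler q = eulerCoeff q := by rw [euler_eq_sum, sum_smul_xi]

theorem dirac_eq : dirac q = (((q : ℂ) - 1)⁻¹ * (q : ℂ) ^ 2) • rinv2 q • euler q := rfl

theorem smul_comm_oneForm (c : ℂ) (f : Alg q) (ω : OneForm q) : f • c • ω = c • f • ω := by
  funext i
  exact mul_smul_comm c f _

end Euler

section Dirac

variable (q : ℝ) [hq : Fact (0 < q)]

/-- The commutator of `x^i` with `g_{jk} x^j ξ^k` is a multiple of `r² ξ^i`; this is what makes the
Dirac operator implement the differential. -/
theorem euler_op_smul_x (i : Fin 3) : euler q <• x q i =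
    x q i • euler q - (((q : ℂ) - 1) * ((q : ℂ) ^ 2)⁻¹) • r2 q • xi q i := by
  have h := hq.out
  have h0 := sq_ne q h
  rw [op_smul_def, rho_x, euler_eq]
  change eulerCoeff q ᵥ* rhoX q i = x q i • eulerCoeff q -
    (((q : ℂ) - 1) * ((q : ℂ) ^ 2)⁻¹) • r2 q • (Pi.single i 1 : Fin 3 → Alg q)
  rw [sq_sq q h, r2_eq, eulerCoeff]
  funext j
  fin_cases i <;> simp only [Fin.zero_eta, Fin.mk_one, Fin.reduceFinMk, rhoX_zero q h,
    rhoX_one q h, rhoX_two q h] <;> fin_cases j <;>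
    simp [Matrix.vecMul, dotProduct, Fin.sum_univ_three, smul_smul, n01 q h, n20 q, n21 q h]
  all_goals try (match_scalars <;> field_simp <;> ring)

theorem euler_op_smul_rinv2 : euler q <• rinv2 q = (q : ℂ) ^ 2 • rinv2 q • euler q := by
  rw [op_smul_def, rho_rinv2, euler_eq]
  change eulerCoeff q ᵥ* _ = (q : ℂ) ^ 2 • rinv2 q • eulerCoeff q
  funext j
  fin_cases j <;> simp [Matrix.vecMul_diagonal, eulerCoeff, x_mul_rinv2 q hq.out]

theorem op_smul_smul (c : ℂ) (f : Alg q) (ω : OneForm q) : (c • ω) <• f = c • (ω <• f) := by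
  rw [op_smul_def, op_smul_def]
  exact Matrix.smul_vecMul c _ _

/-- The differential is the commutator with the Dirac operator, `df = f θ - θ f`: both sides are
derivations, so it is enough to compare them on the generators. -/
theorem d_eq (hq1 : q ≠ 1) (f : Alg q) : d q f = f • dirac q - dirac q <• f := by
  have hc : (q : ℂ) - 1 ≠ 0 := sub_ne_zero.2 (by exact_mod_cast hq1)
  have h0 : (q : ℂ) ≠ 0 := by exact_mod_cast hq.out.ne'
  have hm : ∀ a b, d q a = a • dirac q - dirac q <• a → d q b = b • dirac q - dirac q <• b →
      d q (a * b) = (a * b) • dirac q - dirac q <• (a * b) := by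
    intro a b ha hb
    rw [d_mul, ha, hb, smul_sub, smul_sub, mul_smul, MulOpposite.op_mul, mul_smul,
      smul_comm a (MulOpposite.op b)]
    abel
  have ha : ∀ a b, d q a = a • dirac q - dirac q <• a → d q b = b • dirac q - dirac q <• b →
      d q (a + b) = (a + b) • dirac q - dirac q <• (a + b) := by
    intro a b ha hb
    rw [map_add, ha, hb, add_smul, MulOpposite.op_add, add_smul]
    abel
  have hs : ∀ c : ℂ, d q (algebraMap ℂ (Alg q) c) =
      algebraMap ℂ (Alg q) c • dirac q - dirac q <• algebraMap ℂ (Alg q) c := by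
    intro c
    rw [d_algebraMap, eq_comm, sub_eq_zero, op_smul_def, AlgHom.commutes,
      Algebra.algebraMap_eq_smul_one, Algebra.algebraMap_eq_smul_one, Matrix.vecMul_smul,
      Matrix.vecMul_one, smul_assoc, one_smul]
    rfl
  have hx : ∀ i, d q (x q i) = x q i • dirac q - dirac q <• x q i := by
    intro i
    have : x q i • rinv2 q • euler q = rinv2 q • x q i • euler q := by
      rw [← mul_smul, ← mul_smul, x_mul_rinv2 q hq.out]
    rw [d_x, dirac_eq, op_smul_smul, smul_comm_oneForm, this,
      ← smul_comm (rinv2 q) (MulOpposite.op (x q i)) (euler q), euler_op_smul_x, smul_sub,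
      smul_comm_oneForm, ← mul_smul (rinv2 q) (r2 q), rinv2_mul_r2, one_smul, smul_sub,
      sub_sub_cancel, smul_smul]
    field_simp
    exact (one_smul ℂ _).symm
  refine alg_induction q hs hx ?_ hm ha f
  have hr2 : d q (r2 q) = r2 q • dirac q - dirac q <• r2 q := by
    have hsm : ∀ (c : ℂ) a, d q a = a • dirac q - dirac q <• a →
        d q (c • a) = (c • a) • dirac q - dirac q <• (c • a) := by
      intro c a ha
      rw [Algebra.smul_def]
      exact hm _ _ (hs c) ha
    rw [r2_eq]
    exact ha _ _ (ha _ _ (hsm _ _ (hm _ _ (hx _) (hx _))) (hm _ _ (hx _) (hx _)))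
      (hsm _ _ (hm _ _ (hx _) (hx _)))
  -- A derivation is determined on `r⁻²` by its value on `r²`.
  have h1 : rinv2 q • d q (r2 q) + d q (rinv2 q) <• r2 q = 0 := by
    rw [← d_mul, rinv2_mul_r2, ← map_one (algebraMap ℂ (Alg q)), d_algebraMap]
  have h2 : d q (rinv2 q) = -((rinv2 q • d q (r2 q)) <• rinv2 q) := by
    rw [eq_neg_of_add_eq_zero_left h1, smul_neg, neg_neg, ← mul_smul, ← MulOpposite.op_mul,
      r2_mul_rinv2, MulOpposite.op_one, one_smul]
  rw [h2, hr2, smul_sub, ← mul_smul, rinv2_mul_r2, one_smul, smul_sub,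
    ← smul_comm (rinv2 q), ← mul_smul (MulOpposite.op (rinv2 q)), ← MulOpposite.op_mul,
    r2_mul_rinv2, MulOpposite.op_one, one_smul]
  abel

end Dirac

/-! ### Two-tensors and maps given by matrices -/

section ScalarAction

variable {q : ℝ} {M N : Type*} [AddCommGroup M] [Module (Alg q) M] [Module (Alg q)ᵐᵒᵖ M]
  [SMulCommClass (Alg q) (Alg q)ᵐᵒᵖ M] [AddCommGroup N] [Module (Alg q) N]

/-- Complex scalars act on `M ⊗_A N` through the left action of `A`. -/
noncomputable instance : Module ℂ (BTensor (Alg q) M N) :=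
  Module.compHom _ (algebraMap ℂ (Alg q))

theorem algebraMap_smul_btensor (c : ℂ) (t : BTensor (Alg q) M N) :
    algebraMap ℂ (Alg q) c • t = c • t := rfl

instance : IsScalarTower ℂ (Alg q) (BTensor (Alg q) M N) where
  smul_assoc c a t := by rw [← algebraMap_smul_btensor, ← mul_smul, Algebra.smul_def]

instance : SMulCommClass ℂ (Alg q) (BTensor (Alg q) M N) where
  smul_comm c a t := by
    rw [← algebraMap_smul_btensor, ← algebraMap_smul_btensor, ← mul_smul, ← mul_smul,
      Algebra.commutes]

theorem op_smul_smul_btensor [Module (Alg q)ᵐᵒᵖ N] [SMulCommClass (Alg q) (Alg q)ᵐᵒᵖ N]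
    (c : ℂ) (t : BTensor (Alg q) M N) (f : Alg q) : (c • t) <• f = c • (t <• f) :=
  (smul_comm (algebraMap ℂ (Alg q) c) (MulOpposite.op f) t).symm

end ScalarAction

/-- Additive maps that agree on the elements `m ⊗ ξ^k` are equal, as `m ⊗ f ξ^k = m f ⊗ ξ^k`. -/
theorem hom_ext_xi (q : ℝ) {M P : Type*} [AddCommGroup M] [Module (Alg q)ᵐᵒᵖ M] [AddCommGroup P]
    {f g : BTensor (Alg q) M (OneForm q) →+ P}
    (h : ∀ m k, f (tmul (Alg q) m (xi q k)) = g (tmul (Alg q) m (xi q k))) : f = g := by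
  refine BTensor.hom_ext fun m ω => ?_
  rw [oneForm_eq_sum q ω, tmul_sum, map_sum, map_sum]
  refine Finset.sum_congr rfl fun k _ => ?_
  rw [← BTensor.smul_tmul, h]

section Basis

variable (q : ℝ) [hq : Fact (0 < q)]

theorem op_smul_algebraMap (ω : OneForm q) (c : ℂ) : ω <• algebraMap ℂ (Alg q) c = c • ω := by
  rw [op_smul_def, AlgHom.commutes, Algebra.algebraMap_eq_smul_one, Matrix.vecMul_smul,
    Matrix.vecMul_one]
  rfl

theorem tmul_smul_oneForm {N : Type*} [AddCommGroup N] [Module (Alg q) N]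
    (c : ℂ) (ω : OneForm q) (n : N) :
    tmul (Alg q) (c • ω) n = c • tmul (Alg q) ω n := by
  rw [← algebraMap_smul_btensor, left_smul_tmul, algebraMap_smul]

theorem tmul_complex_smul {N : Type*} [AddCommGroup N] [Module (Alg q) N]
    [Module (Alg q)ᵐᵒᵖ N] [SMulCommClass (Alg q) (Alg q)ᵐᵒᵖ N]
    (c : ℂ) (ω : OneForm q) (t : BTensor (Alg q) N (OneForm q)) :
    tmul (Alg q) ω (c • t) = c • tmul (Alg q) ω t := by
  rw [← algebraMap_smul_btensor, ← BTensor.smul_tmul, op_smul_algebraMap, tmul_smul_oneForm]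

theorem tmul_complex_smul' (c : ℂ) (ω η : OneForm q) :
    tmul (Alg q) ω (c • η) = c • tmul (Alg q) ω η := by
  rw [← algebraMap_smul (Alg q) c η, ← BTensor.smul_tmul, op_smul_algebraMap, tmul_smul_oneForm]

/-- The basic two-tensors `ξ^i ⊗ ξ^j`. -/
noncomputable def xi2 (i j : Fin 3) : BTensor (Alg q) (OneForm q) (OneForm q) :=
  tmul (Alg q) (xi q i) (xi q j)

/-- The basic three-tensors `(ξ^i ⊗ ξ^j) ⊗ ξ^k`. -/
noncomputable def xi3 (i j k : Fin 3) :
    BTensor (Alg q) (BTensor (Alg q) (OneForm q) (OneForm q)) (OneForm q) :=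
  tmul (Alg q) (xi2 q i j) (xi q k)

theorem hom_ext_xi2 {P : Type*} [AddCommGroup P] [Module (Alg q) P]
    {f g : BTensor (Alg q) (OneForm q) (OneForm q) →+ P}
    (hf : ∀ (a : Alg q) t, f (a • t) = a • f t) (hg : ∀ (a : Alg q) t, g (a • t) = a • g t)
    (h : ∀ i j, f (xi2 q i j) = g (xi2 q i j)) : f = g := by
  refine hom_ext_xi q fun ω k => ?_
  rw [oneForm_eq_sum q ω, sum_tmul, map_sum, map_sum]
  refine Finset.sum_congr rfl fun i _ => ?_
  rw [← left_smul_tmul, hf, hg]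
  exact congrArg _ (h i k)

theorem hom_ext_xi3 {P : Type*} [AddCommGroup P] [Module (Alg q) P]
    {f g : BTensor (Alg q) (BTensor (Alg q) (OneForm q) (OneForm q)) (OneForm q) →+ P}
    (hf : ∀ (a : Alg q) t, f (a • t) = a • f t) (hg : ∀ (a : Alg q) t, g (a • t) = a • g t)
    (h : ∀ i j k, f (xi3 q i j k) = g (xi3 q i j k)) : f = g := by
  refine hom_ext_xi q fun t k => ?_
  have := hom_ext_xi2 q
    (f := f.comp ((BTensor.mk _ _ _).flip (xi q k)))
    (g := g.comp ((BTensor.mk _ _ _).flip (xi q k)))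
    (fun a t => hf a (tmul _ t (xi q k)))
    (fun a t => hg a (tmul _ t (xi q k))) (fun i j => h i j k)
  exact DFunLike.congr_fun this t

/-- The coefficients `f_{ij}` of a two-tensor `∑ f_{ij} ξ^i ⊗ ξ^j`: those of `ω ⊗ f ξ^j = ω f ⊗ ξ^j`
are the coefficients of the one-form `ω f`. -/
noncomputable def coeff :
    BTensor (Alg q) (OneForm q) (OneForm q) →+ Fin 3 → Fin 3 → Alg q :=
  BTensor.lift (AddMonoidHom.mk' (fun ω => AddMonoidHom.mk'
    (fun η i j => (show Fin 3 → Alg q from ω <• (show Fin 3 → Alg q from η) j) i)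
    (fun η η' => by
      funext i j
      change (ω <• ((show Fin 3 → Alg q from η) j + (show Fin 3 → Alg q from η') j) :
        Fin 3 → Alg q) i = _
      rw [MulOpposite.op_add, add_smul]; rfl))
    (fun ω ω' => by
      ext η i j
      change ((ω + ω') <• (show Fin 3 → Alg q from η) j : Fin 3 → Alg q) i = _
      rw [smul_add]; rfl))
    (by
      intro ω a η
      funext i j
      change (ω <• a <• (show Fin 3 → Alg q from η) j : Fin 3 → Alg q) i =
        (ω <• (a * (show Fin 3 → Alg q from η) j) : Fin 3 → Alg q) i
      rw [MulOpposite.op_mul, mul_smul])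

theorem coeff_tmul (ω η : OneForm q) (i j : Fin 3) : coeff q (tmul (Alg q) ω η) i j =
    (show Fin 3 → Alg q from ω <• (show Fin 3 → Alg q from η) j) i := rfl

theorem coeff_smul (a : Alg q) (t : BTensor (Alg q) (OneForm q) (OneForm q)) :
    coeff q (a • t) = a • coeff q t := by
  induction t using BTensor.induction with
  | h0 => simp
  | ht ω η =>
    funext i j
    rw [left_smul_tmul, coeff_tmul, ← smul_comm a]
    rfl
  | ha s t hs ht => simp only [smul_add, map_add, hs, ht]

theorem coeff_xi2 (i j k l : Fin 3) :
    coeff q (xi2 q i j) k l = if i = k ∧ j = l then 1 else 0 := by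
  rw [xi2, coeff_tmul]
  have : (show Fin 3 → Alg q from xi q j) l = algebraMap ℂ (Alg q) (if j = l then 1 else 0) := by
    change (Pi.single j 1 : Fin 3 → Alg q) l = _
    rw [Pi.single_apply, apply_ite (algebraMap ℂ (Alg q)), map_one, map_zero]
    simp only [eq_comm]
  rw [this, op_smul_algebraMap]
  change (if j = l then (1 : ℂ) else 0) • (Pi.single i 1 : Fin 3 → Alg q) k = _
  rw [Pi.single_apply]
  by_cases h1 : i = k <;> by_cases h2 : j = l <;> simp [h1, h2, eq_comm]

/-- The left linear map of `Ω¹ ⊗_A Ω¹` with `ξ^i ⊗ ξ^j ↦ M^{ij}_{hk} ξ^h ⊗ ξ^k`. -/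
noncomputable def matrixMap (M : Matrix (Fin 3 × Fin 3) (Fin 3 × Fin 3) ℂ) :
    BTensor (Alg q) (OneForm q) (OneForm q) →+ BTensor (Alg q) (OneForm q) (OneForm q) :=
  AddMonoidHom.mk'
    (fun t => ∑ i, ∑ j, coeff q t i j • ∑ h, ∑ k, M (i, j) (h, k) • xi2 q h k)
    (fun s t => by
      simp only [map_add, Pi.add_apply, add_smul, Finset.sum_add_distrib])

variable (M N : Matrix (Fin 3 × Fin 3) (Fin 3 × Fin 3) ℂ)

theorem matrixMap_apply (t : BTensor (Alg q) (OneForm q) (OneForm q)) :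
    matrixMap q M t = ∑ i, ∑ j, coeff q t i j • ∑ h, ∑ k, M (i, j) (h, k) • xi2 q h k := rfl

theorem matrixMap_smul (a : Alg q) (t : BTensor (Alg q) (OneForm q) (OneForm q)) :
    matrixMap q M (a • t) = a • matrixMap q M t := by
  simp only [matrixMap_apply, coeff_smul, Pi.smul_apply, smul_eq_mul, mul_smul,
    Finset.smul_sum (r := a)]

theorem matrixMap_complex_smul (c : ℂ) (t : BTensor (Alg q) (OneForm q) (OneForm q)) :
    matrixMap q M (c • t) = c • matrixMap q M t :=
  matrixMap_smul q M _ t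

theorem matrixMap_xi2 (i j : Fin 3) :
    matrixMap q M (xi2 q i j) = ∑ h, ∑ k, M (i, j) (h, k) • xi2 q h k := by
  change ∑ a, ∑ b, coeff q (xi2 q i j) a b • ∑ h, ∑ k, M (a, b) (h, k) • xi2 q h k = _
  simp only [coeff_xi2, ite_and, ite_smul, one_smul, zero_smul, Finset.sum_ite_eq,
    Finset.mem_univ, if_true, Finset.sum_ite_irrel, Finset.sum_const_zero]

/-- Indices are contracted with the rows of the matrices, so composition reverses products. -/
theorem matrixMap_matrixMap (t : BTensor (Alg q) (OneForm q) (OneForm q)) :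
    matrixMap q M (matrixMap q N t) = matrixMap q (N * M) t := by
  have : (matrixMap q M).comp (matrixMap q N) = matrixMap q (N * M) := by
    refine hom_ext_xi2 q (fun a t => ?_) (matrixMap_smul q _) fun i j => ?_
    · simp only [AddMonoidHom.comp_apply, matrixMap_smul]
    · simp only [AddMonoidHom.comp_apply, matrixMap_xi2, map_sum, matrixMap_complex_smul,
        Matrix.mul_apply, Fintype.sum_prod_type, Finset.sum_smul, Finset.smul_sum, smul_smul]
      simp only [Fin.sum_univ_three]
      abel
  exact DFunLike.congr_fun this t

theorem matrixMap_one (t : BTensor (Alg q) (OneForm q) (OneForm q)) : matrixMap q 1 t = t := by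
  have : matrixMap q 1 = AddMonoidHom.id _ := by
    refine hom_ext_xi2 q (matrixMap_smul q _) (fun _ _ => rfl) fun i j => ?_
    simp only [matrixMap_xi2, Matrix.one_apply, Prod.mk.injEq, ite_and, ite_smul, one_smul,
      zero_smul, Finset.sum_ite_eq, Finset.mem_univ, if_true, Finset.sum_ite_irrel,
      Finset.sum_const_zero, AddMonoidHom.id_apply]
  exact DFunLike.congr_fun this t

theorem matrixMap_add (t : BTensor (Alg q) (OneForm q) (OneForm q)) :
    matrixMap q (M + N) t = matrixMap q M t + matrixMap q N t := by
  simp only [matrixMap_apply, Matrix.add_apply, add_smul, Finset.sum_add_distrib, smul_add]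

theorem eq_matrixMap {σ : BTensor (Alg q) (OneForm q) (OneForm q) →+
      BTensor (Alg q) (OneForm q) (OneForm q)} (hσ : ∀ (a : Alg q) t, σ (a • t) = a • σ t)
    (h : ∀ i j, σ (xi2 q i j) = ∑ h, ∑ k, M (i, j) (h, k) • xi2 q h k) :
    σ = matrixMap q M :=
  hom_ext_xi2 q hσ (matrixMap_smul q M) fun i j => by rw [h, matrixMap_xi2]

end Basis

/-! ### Right linearity and the braid equation of the generalized flips -/

section Flip

variable (q : ℝ) [hq : Fact (0 < q)]

theorem xi_op_smul_x' (k l : Fin 3) : xi q k <• x q l =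
    ∑ i, ∑ j, ((q : ℂ) • braid q)⁻¹ (k, l) (i, j) • (x q i • xi q j) := by
  rw [xi_op_smul_x, Finset.sum_comm]

/-- Moving a coordinate to the left of `ξ^i ⊗ ξ^j` applies `(q R̂)⁻¹` in two neighbouring places. -/
theorem xi2_op_smul_x (i j l : Fin 3) : xi2 q i j <• x q l =
    ∑ a, ∑ b, ((q : ℂ) • braid q)⁻¹ (j, l) (a, b) •
      ∑ c, ∑ d, ((q : ℂ) • braid q)⁻¹ (i, a) (c, d) • (x q c • xi2 q d b) := by
  rw [xi2, op_smul_tmul, xi_op_smul_x', tmul_sum]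
  refine Finset.sum_congr rfl fun a _ => ?_
  rw [tmul_sum]
  refine Finset.sum_congr rfl fun b _ => ?_
  rw [tmul_complex_smul', ← BTensor.smul_tmul, xi_op_smul_x', sum_tmul]
  congr 1
  refine Finset.sum_congr rfl fun c _ => ?_
  rw [sum_tmul]
  refine Finset.sum_congr rfl fun d _ => ?_
  rw [tmul_smul_oneForm, xi2, left_smul_tmul]

theorem xi_op_smul_rinv2 (i : Fin 3) : xi q i <• rinv2 q = (q : ℂ) ^ 2 • rinv2 q • xi q i := by
  rw [xi_op_smul, rho_rinv2]
  simp [Matrix.diagonal_apply, ite_smul]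

theorem xi2_op_smul_rinv2 (i j : Fin 3) :
    xi2 q i j <• rinv2 q = ((q : ℂ) ^ 2 * (q : ℂ) ^ 2) • rinv2 q • xi2 q i j := by
  rw [xi2, op_smul_tmul, xi_op_smul_rinv2, tmul_complex_smul', ← BTensor.smul_tmul,
    xi_op_smul_rinv2, tmul_smul_oneForm, smul_smul, left_smul_tmul]

/-- The left linear map `matrixMap q M` is right linear if it commutes with the right multiplication
of the basic two-tensors by the coordinates and by `r⁻²`. -/
theorem matrixMap_op_smul_of_basis (M : Matrix (Fin 3 × Fin 3) (Fin 3 × Fin 3) ℂ)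
    (hx : ∀ i j l, matrixMap q M (xi2 q i j <• x q l) = matrixMap q M (xi2 q i j) <• x q l)
    (hr : ∀ i j, matrixMap q M (xi2 q i j <• rinv2 q) = matrixMap q M (xi2 q i j) <• rinv2 q)
    (t : BTensor (Alg q) (OneForm q) (OneForm q)) (f : Alg q) :
    matrixMap q M (t <• f) = matrixMap q M t <• f := by
  have key : ∀ g : Alg q, (∀ i j, matrixMap q M (xi2 q i j <• g) = matrixMap q M (xi2 q i j) <• g) →
      ∀ t, matrixMap q M (t <• g) = matrixMap q M t <• g := by
    intro g hg
    let r : BTensor (Alg q) (OneForm q) (OneForm q) →+ BTensor (Alg q) (OneForm q) (OneForm q) :=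
      DistribSMul.toAddMonoidHom _ (MulOpposite.op g)
    have hr' : ∀ t, r t = t <• g := fun _ => rfl
    have hr : ∀ (a : Alg q) t, r (a • t) = a • r t := fun a t =>
      (smul_comm a (MulOpposite.op g) t).symm
    have e : (matrixMap q M).comp r = r.comp (matrixMap q M) :=
      hom_ext_xi2 q
        (fun a t => by rw [AddMonoidHom.comp_apply, hr, matrixMap_smul, AddMonoidHom.comp_apply])
        (fun a t => by rw [AddMonoidHom.comp_apply, matrixMap_smul, hr, AddMonoidHom.comp_apply])
        (fun i j => by
          rw [AddMonoidHom.comp_apply, AddMonoidHom.comp_apply, hr', hr', hg])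
    intro t
    have et := DFunLike.congr_fun e t
    rwa [AddMonoidHom.comp_apply, AddMonoidHom.comp_apply, hr', hr'] at et
  revert t
  refine alg_induction q (p := fun f => ∀ t, matrixMap q M (t <• f) = matrixMap q M t <• f)
    (fun c => key _ fun i j => ?_) (fun l => key _ fun i j => hx i j l)
    (key _ hr) (fun a b ha hb t => ?_) (fun a b ha hb t => ?_) f
  · have : ∀ t : BTensor (Alg q) (OneForm q) (OneForm q),
        t <• algebraMap ℂ (Alg q) c = c • t := by
      intro t
      induction t using BTensor.induction with
      | h0 => simp
      | ht ω η => rw [op_smul_tmul, op_smul_algebraMap, tmul_complex_smul']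
      | ha s t hs ht => rw [smul_add, smul_add, hs, ht]
    rw [this, this, matrixMap_complex_smul]
  · rw [MulOpposite.op_mul, mul_smul, hb, ha, ← mul_smul]
  · rw [MulOpposite.op_add, add_smul, map_add, ha, hb, add_smul]

theorem matrixMap_inv_braid_op_smul (t : BTensor (Alg q) (OneForm q) (OneForm q)) (f : Alg q) :
    matrixMap q ((q : ℂ) • braid q)⁻¹ (t <• f) = matrixMap q ((q : ℂ) • braid q)⁻¹ t <• f := by
  refine matrixMap_op_smul_of_basis q _ (fun i j l => ?_) (fun i j => ?_) t f
  · have hYB := inv_braid_yangBaxter hq.out (fun c e f => x q c • xi2 q e f) i j l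
    rw [xi2_op_smul_x, matrixMap_xi2]
    simp only [map_sum, matrixMap_complex_smul, matrixMap_smul, matrixMap_xi2]
    simp only [Finset.smul_sum (r := MulOpposite.op (x q l)), op_smul_smul_btensor, xi2_op_smul_x]
    simp only [Finset.smul_sum (r := x q _), ← smul_comm (_ : ℂ) (x q _)]
    rw [hYB]
  · rw [xi2_op_smul_rinv2, matrixMap_complex_smul, matrixMap_smul, matrixMap_xi2]
    simp only [Finset.smul_sum, op_smul_smul_btensor, xi2_op_smul_rinv2]
    simp only [smul_comm (rinv2 q) (_ : ℂ), smul_smul, mul_comm]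

theorem isUnit_det_braid : IsUnit ((q : ℂ) • braid q).det :=
  Matrix.isUnit_det_of_right_inverse (braid_mul q hq.out)

theorem matrixMap_braid_inv_braid (t : BTensor (Alg q) (OneForm q) (OneForm q)) :
    matrixMap q ((q : ℂ) • braid q) (matrixMap q ((q : ℂ) • braid q)⁻¹ t) = t := by
  rw [matrixMap_matrixMap, Matrix.nonsing_inv_mul _ (isUnit_det_braid q), matrixMap_one]

theorem matrixMap_inv_braid_braid (t : BTensor (Alg q) (OneForm q) (OneForm q)) :
    matrixMap q ((q : ℂ) • braid q)⁻¹ (matrixMap q ((q : ℂ) • braid q) t) = t := by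
  rw [matrixMap_matrixMap, Matrix.mul_nonsing_inv _ (isUnit_det_braid q), matrixMap_one]

theorem matrixMap_braid_op_smul (t : BTensor (Alg q) (OneForm q) (OneForm q)) (f : Alg q) :
    matrixMap q ((q : ℂ) • braid q) (t <• f) = matrixMap q ((q : ℂ) • braid q) t <• f := by
  rw [← matrixMap_braid_inv_braid q (matrixMap q ((q : ℂ) • braid q) t <• f),
    matrixMap_inv_braid_op_smul, matrixMap_inv_braid_braid]

theorem leg12_matrixMap_xi3 (M : Matrix (Fin 3 × Fin 3) (Fin 3 × Fin 3) ℂ)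
    (hr : ∀ t (a : Alg q), matrixMap q M (t <• a) = matrixMap q M t <• a) (i j k : Fin 3) :
    leg12 (matrixMap q M) hr (xi3 q i j k) = ∑ a, ∑ b, M (i, j) (a, b) • xi3 q a b k := by
  rw [xi3, leg12_tmul, matrixMap_xi2, sum_tmul]
  simp only [sum_tmul]
  rfl

theorem leg23_matrixMap_xi3 (M : Matrix (Fin 3 × Fin 3) (Fin 3 × Fin 3) ℂ) (i j k : Fin 3) :
    leg23 (matrixMap q M) (matrixMap_smul q M) (xi3 q i j k) =
      ∑ a, ∑ b, M (j, k) (a, b) • xi3 q i a b := by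
  rw [xi3, xi2, leg23_tmul]
  change assocInv _ _ _ _ (tmul (Alg q) (xi q i) (matrixMap q M (xi2 q j k))) = _
  have h : ∀ (c : ℂ) t, assocInv (Alg q) (OneForm q) (OneForm q) (OneForm q) (c • t) =
      c • assocInv _ _ _ _ t := fun c t => assocInv_smul (algebraMap ℂ (Alg q) c) t
  simp only [matrixMap_xi2, tmul_sum, map_sum, tmul_complex_smul, h]
  rfl

theorem leg_inv_braid_yangBaxter
    (t : BTensor (Alg q) (BTensor (Alg q) (OneForm q) (OneForm q)) (OneForm q)) :
    leg12 (matrixMap q ((q : ℂ) • braid q)⁻¹) (matrixMap_inv_braid_op_smul q)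
      (leg23 (matrixMap q ((q : ℂ) • braid q)⁻¹) (matrixMap_smul q _)
        (leg12 (matrixMap q ((q : ℂ) • braid q)⁻¹) (matrixMap_inv_braid_op_smul q) t)) =
    leg23 (matrixMap q ((q : ℂ) • braid q)⁻¹) (matrixMap_smul q _)
      (leg12 (matrixMap q ((q : ℂ) • braid q)⁻¹) (matrixMap_inv_braid_op_smul q)
        (leg23 (matrixMap q ((q : ℂ) • braid q)⁻¹) (matrixMap_smul q _) t)) := by
  set s12 := leg12 (matrixMap q ((q : ℂ) • braid q)⁻¹) (matrixMap_inv_braid_op_smul q)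
  set s23 := leg23 (matrixMap q ((q : ℂ) • braid q)⁻¹) (matrixMap_smul q _)
  have h12 : ∀ (a : Alg q) t, s12 (a • t) = a • s12 t := fun a t =>
    leg12_smul a t (matrixMap_smul q _)
  have h23 : ∀ (a : Alg q) t, s23 (a • t) = a • s23 t := fun a t => leg23_smul a t
  have c12 : ∀ (c : ℂ) t, s12 (c • t) = c • s12 t := fun c t => h12 _ t
  have c23 : ∀ (c : ℂ) t, s23 (c • t) = c • s23 t := fun c t => h23 _ t
  have x12 : ∀ i j k, s12 (xi3 q i j k) =
      ∑ a, ∑ b, ((q : ℂ) • braid q)⁻¹ (i, j) (a, b) • xi3 q a b k :=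
    leg12_matrixMap_xi3 q _ (matrixMap_inv_braid_op_smul q)
  have x23 : ∀ i j k, s23 (xi3 q i j k) =
      ∑ a, ∑ b, ((q : ℂ) • braid q)⁻¹ (j, k) (a, b) • xi3 q i a b :=
    leg23_matrixMap_xi3 q _
  have e : s12.comp (s23.comp s12) = s23.comp (s12.comp s23) := by
    refine hom_ext_xi3 q (fun a t => ?_) (fun a t => ?_) fun i j k => ?_
    · simp only [AddMonoidHom.comp_apply, h12, h23]
    · simp only [AddMonoidHom.comp_apply, h12, h23]
    · simp only [AddMonoidHom.comp_apply, x12, x23, map_sum, c12, c23]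
      exact (inv_braid_yangBaxter hq.out (fun c e f => xi3 q c e f) i j k).symm
  exact DFunLike.congr_fun e t

/-- The braid equation for `q R̂`, obtained by inverting the one for `(q R̂)⁻¹`. -/
theorem leg_braid_yangBaxter
    (t : BTensor (Alg q) (BTensor (Alg q) (OneForm q) (OneForm q)) (OneForm q)) :
    leg12 (matrixMap q ((q : ℂ) • braid q)) (matrixMap_braid_op_smul q)
      (leg23 (matrixMap q ((q : ℂ) • braid q)) (matrixMap_smul q _)
        (leg12 (matrixMap q ((q : ℂ) • braid q)) (matrixMap_braid_op_smul q) t)) =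
    leg23 (matrixMap q ((q : ℂ) • braid q)) (matrixMap_smul q _)
      (leg12 (matrixMap q ((q : ℂ) • braid q)) (matrixMap_braid_op_smul q)
        (leg23 (matrixMap q ((q : ℂ) • braid q)) (matrixMap_smul q _) t)) := by
  set s12 := leg12 (matrixMap q ((q : ℂ) • braid q)) (matrixMap_braid_op_smul q)
  set s23 := leg23 (matrixMap q ((q : ℂ) • braid q)) (matrixMap_smul q _)
  set u12 := leg12 (matrixMap q ((q : ℂ) • braid q)⁻¹) (matrixMap_inv_braid_op_smul q)
  set u23 := leg23 (matrixMap q ((q : ℂ) • braid q)⁻¹) (matrixMap_smul q _)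
  have su12 : ∀ t, s12 (u12 t) = t := leg12_leg12 (matrixMap_braid_inv_braid q)
  have us12 : ∀ t, u12 (s12 t) = t := leg12_leg12 (matrixMap_inv_braid_braid q)
  have su23 : ∀ t, s23 (u23 t) = t := leg23_leg23 (matrixMap_braid_inv_braid q)
  have us23 : ∀ t, u23 (s23 t) = t := leg23_leg23 (matrixMap_inv_braid_braid q)
  have h : u23 (u12 (u23 (s12 (s23 (s12 t))))) = t := by
    rw [← leg_inv_braid_yangBaxter q, us12, us23, us12]
  rw [← su23 (s12 (s23 (s12 t))), ← su12 (u23 _), ← su23 (u12 _), h]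

end Flip

/-! ### Two-forms and the square of the Dirac operator -/

section Projectors

variable (q : ℝ) [hq : Fact (0 < q)]

theorem projS_mul_projS : projS q * projS q = projS q := by
  simp only [projS, sub_mul, mul_sub, one_mul, mul_one, projA_mul_projA q hq.out,
    projT_mul_projT q hq.out, projA_mul_projT q hq.out, projT_mul_projA q hq.out]
  abel

theorem projS_mul_projT : projS q * projT q = 0 := by
  simp only [projS, sub_mul, one_mul, projT_mul_projT q hq.out, projA_mul_projT q hq.out]
  abel

theorem projT_mul_projS : projT q * projS q = 0 := by
  simp only [projS, mul_sub, mul_one, projT_mul_projT q hq.out, projT_mul_projA q hq.out]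
  abel

theorem one_add_braid : 1 + (q : ℂ) • braid q =
    (1 + (q : ℂ) ^ 2) • projS q + (1 + (q : ℂ)⁻¹) • projT q := by
  have h0 : (q : ℂ) ≠ 0 := by exact_mod_cast hq.out.ne'
  rw [braid, projS]
  match_scalars <;> field_simp <;> ring

theorem one_add_inv_braid : 1 + ((q : ℂ) • braid q)⁻¹ =
    (1 + ((q : ℂ) ^ 2)⁻¹) • projS q + (1 + (q : ℂ)) • projT q := by
  have h0 : (q : ℂ) ≠ 0 := by exact_mod_cast hq.out.ne'
  rw [inv_braid q hq.out, projS]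
  match_scalars <;> field_simp <;> ring

theorem wedge_matrixMap_of_mem {P : Matrix (Fin 3 × Fin 3) (Fin 3 × Fin 3) ℂ}
    (hP : P = projS q ∨ P = projT q) (t : BTensor (Alg q) (OneForm q) (OneForm q)) :
    wedge q (matrixMap q P t) = 0 := by
  have hw : ∀ (a : Alg q) t, wedge q (a • t) = a • wedge q t := fun a t =>
    map_smul (QuotBimodule.proj (A := Alg q) (twoFormRel q)) a t
  have h : (wedge q).comp (matrixMap q P) = 0 := by
    refine hom_ext_xi2 q (fun a t => ?_) (fun a t => ?_) fun i j => ?_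
    · rw [AddMonoidHom.comp_apply, matrixMap_smul, hw, AddMonoidHom.comp_apply]
    · rw [AddMonoidHom.zero_apply, AddMonoidHom.zero_apply, smul_zero]
    · rw [AddMonoidHom.comp_apply, matrixMap_xi2, AddMonoidHom.zero_apply]
      refine (Submodule.Quotient.mk_eq_zero _).2 (Submodule.subset_span
        ⟨_, ⟨P, hP, i, j, rfl⟩, 1, ?_⟩)
      rw [MulOpposite.op_one, one_smul]
      rfl
  exact DFunLike.congr_fun h t

/-- The flip of `S` becomes `-1` on two-forms, because `1 + S` is a combination of the projectors
`P_s` and `P_t` that are divided out. -/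
theorem wedge_matrixMap {S : Matrix (Fin 3 × Fin 3) (Fin 3 × Fin 3) ℂ} {a b : ℂ}
    (hS : 1 + S = a • projS q + b • projT q) (t : BTensor (Alg q) (OneForm q) (OneForm q)) :
    wedge q (matrixMap q S t) = -wedge q t := by
  have hsm : ∀ (c : ℂ) P, matrixMap q (c • P) t = matrixMap q P (c • t) := by
    intro c P
    rw [matrixMap_complex_smul, matrixMap_apply, matrixMap_apply]
    simp only [Matrix.smul_apply, smul_eq_mul, mul_smul, Finset.smul_sum, smul_comm c]
  have h : matrixMap q (1 + S) t =
      matrixMap q (projS q) (a • t) + matrixMap q (projT q) (b • t) := by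
    rw [hS, matrixMap_add, hsm, hsm]
  rw [matrixMap_add, matrixMap_one] at h
  have h' := congrArg (wedge q) h
  rw [map_add, map_add, wedge_matrixMap_of_mem q (.inl rfl), wedge_matrixMap_of_mem q (.inr rfl),
    add_zero] at h'
  exact eq_neg_of_add_eq_zero_right h'

/-- The relations `P_a x x = 0` for the lowered coordinates `g_{ij} x^i`, in reversed order. -/
theorem eulerCoeff_eps (c : Fin 3) :
    ∑ i, ∑ j, eps q c i j • (eulerCoeff q j * eulerCoeff q i) = 0 := by
  have h0 := sq_ne q hq.out
  fin_cases c <;>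
    simp [-Complex.coe_smul, eps, eulerCoeff, hpar, Fin.sum_univ_three, smul_smul, n01 q hq.out,
      n20 q, n21 q hq.out, sq_sq q hq.out]
  all_goals try (match_scalars <;> field_simp <;> ring)

/-- `P_a` kills the two-tensors whose coefficients are orthogonal to the vectors spanning the image
of `P_a`. -/
theorem matrixMap_projA_eq_zero (f : Fin 3 → Fin 3 → Alg q)
    (hf : ∀ c, ∑ i, ∑ j, eps q c i j • f i j = 0) :
    matrixMap q (projA q) (∑ i, ∑ j, f i j • xi2 q i j) = 0 := by
  obtain ⟨w, hw⟩ : ∃ w : Fin 3 → ℂ, ∀ c, (∑ m, ∑ n, eps q c m n ^ 2)⁻¹ = w c := ⟨_, fun _ => rfl⟩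
  have h1 : ∀ i j, ∑ h, ∑ k, projA q (i, j) (h, k) • xi2 q h k =
      ∑ c, (w c * eps q c i j) • ∑ h, ∑ k, eps q c h k • xi2 q h k := by
    intro i j
    simp only [projA, Matrix.of_apply, Finset.sum_smul, Finset.smul_sum, smul_smul]
    rw [Finset.sum_comm (s := Finset.univ (α := Fin 3)) (t := Finset.univ (α := Fin 3))
      (f := fun c h => ∑ k, (w c * eps q c i j * eps q c h k) • xi2 q h k)]
    refine Finset.sum_congr rfl fun h _ => ?_
    rw [Finset.sum_comm]
    refine Finset.sum_congr rfl fun c _ => Finset.sum_congr rfl fun k _ => ?_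
    rw [← hw]
    congr 1
    ring
  calc matrixMap q (projA q) (∑ i, ∑ j, f i j • xi2 q i j)
      = ∑ i, ∑ j, ∑ c, w c • ((eps q c i j • f i j) • ∑ h, ∑ k, eps q c h k • xi2 q h k) := by
        simp only [map_sum, matrixMap_smul, matrixMap_xi2, h1]
        refine Finset.sum_congr rfl fun i _ => Finset.sum_congr rfl fun j _ => ?_
        rw [Finset.smul_sum]
        refine Finset.sum_congr rfl fun c _ => ?_
        rw [← smul_comm (w c * eps q c i j), mul_smul, smul_assoc]
    _ = ∑ c, w c • ((∑ i, ∑ j, eps q c i j • f i j) • ∑ h, ∑ k, eps q c h k • xi2 q h k) := by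
        obtain ⟨Y, hY⟩ : ∃ Y : Fin 3 → BTensor (Alg q) (OneForm q) (OneForm q),
          ∀ c, ∑ h, ∑ k, eps q c h k • xi2 q h k = Y c := ⟨_, fun _ => rfl⟩
        simp only [hY, Finset.sum_smul, Finset.smul_sum]
        symm
        rw [Finset.sum_comm]
        refine Finset.sum_congr rfl fun i _ => ?_
        rw [Finset.sum_comm]
    _ = 0 := by simp only [hf, zero_smul, smul_zero, Finset.sum_const_zero]

theorem op_smul_complex (c : ℂ) (f : Alg q) (ω : OneForm q) : ω <• (c • f) = c • (ω <• f) := by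
  rw [MulOpposite.op_smul, smul_assoc]

theorem euler_op_smul_eulerCoeff (k : Fin 3) : euler q <• eulerCoeff q k =
    eulerCoeff q k • euler q -
      (((q : ℂ) - 1) * ((q : ℂ) ^ 2)⁻¹) • r2 q • ∑ m, metric q m k • xi q m := by
  rw [eulerCoeff_eq_sum]
  simp only [Finset.op_sum, Finset.sum_smul, op_smul_complex, euler_op_smul_x, smul_sub,
    Finset.sum_sub_distrib, Finset.smul_sum, smul_assoc, smul_comm_oneForm]
  simp only [smul_comm (metric q _ _) (((q : ℂ) - 1) * ((q : ℂ) ^ 2)⁻¹)]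

/-- The only part of `euler ⊗ euler` that does not come from a product of coordinates is a multiple
of the metric, since `euler` commutes with the coordinates up to multiples of `r² ξ^i`. -/
theorem euler_tmul_euler : tmul (Alg q) (euler q) (euler q) =
    (∑ i, ∑ j, (eulerCoeff q j * eulerCoeff q i) • xi2 q i j) -
      (((q : ℂ) - 1) * ((q : ℂ) ^ 2)⁻¹) • r2 q • ∑ i, ∑ j, metric q i j • xi2 q i j := by
  have h : ∀ k, tmul (Alg q) (euler q) (eulerCoeff q k • xi q k) =
      (∑ i, (eulerCoeff q k * eulerCoeff q i) • xi2 q i k) -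
      (((q : ℂ) - 1) * ((q : ℂ) ^ 2)⁻¹) • r2 q • ∑ i, metric q i k • xi2 q i k := by
    intro k
    rw [← BTensor.smul_tmul, euler_op_smul_eulerCoeff, sub_tmul, tmul_smul_oneForm,
      ← left_smul_tmul, ← left_smul_tmul, sum_tmul, euler_eq_sum, sum_tmul]
    simp only [tmul_smul_oneForm, ← left_smul_tmul, Finset.smul_sum (r := eulerCoeff q k),
      mul_smul]
    rfl
  conv_lhs => rw [euler_eq_sum q, tmul_sum, ← euler_eq_sum q]
  rw [Finset.sum_congr rfl fun k _ => h k, Finset.sum_sub_distrib,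
    Finset.sum_comm, ← Finset.smul_sum, ← Finset.smul_sum,
    Finset.sum_comm (f := fun k i => metric q i k • xi2 q i k)]

/-- `θ ∧ θ = 0`, in the form `P_a (θ ⊗ θ) = 0`: the two parts of `euler ⊗ euler` are killed by the
relations of the algebra and by the orthogonality of `P_a` and `P_t`. -/
theorem matrixMap_projA_dirac :
    matrixMap q (projA q) (tmul (Alg q) (dirac q) (dirac q)) = 0 := by
  have hg : matrixMap q (projA q) (∑ i, ∑ j, metric q i j • xi2 q i j) = 0 := by
    refine matrixMap_projA_eq_zero q (fun i j => algebraMap ℂ (Alg q) (metric q i j)) fun c => ?_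
    have h := eps_metric q hq.out c
    rw [Fintype.sum_prod_type] at h
    have h' := congrArg (algebraMap ℂ (Alg q)) h
    simpa only [map_sum, map_mul, map_zero, Algebra.smul_def] using h'
  have he : matrixMap q (projA q) (tmul (Alg q) (euler q) (euler q)) = 0 := by
    rw [euler_tmul_euler, map_sub, matrixMap_complex_smul, matrixMap_smul, hg, smul_zero,
      smul_zero, sub_zero]
    exact matrixMap_projA_eq_zero q _ (eulerCoeff_eps q)
  rw [dirac_eq, tmul_smul_oneForm, tmul_complex_smul', ← BTensor.smul_tmul, ← smul_comm (rinv2 q),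
    euler_op_smul_rinv2, ← left_smul_tmul, tmul_smul_oneForm, ← left_smul_tmul]
  simp only [matrixMap_complex_smul, matrixMap_smul, he, smul_zero]

/-- `θ ⊗ θ` lies in the image of `1 + σ`, which is that of `P_s + P_t = 1 - P_a` because `1 + S` is
invertible there. -/
theorem dirac_tmul_dirac {S : Matrix (Fin 3 × Fin 3) (Fin 3 × Fin 3) ℂ} {a b : ℂ} (ha : a ≠ 0)
    (hb : b ≠ 0) (hS : 1 + S = a • projS q + b • projT q) :
    ∃ t, tmul (Alg q) (dirac q) (dirac q) = t + matrixMap q S t := by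
  set T := tmul (Alg q) (dirac q) (dirac q)
  refine ⟨matrixMap q (a⁻¹ • projS q + b⁻¹ • projT q) T, ?_⟩
  have h1 : (a⁻¹ • projS q + b⁻¹ • projT q) * (1 + S) = projS q + projT q := by
    rw [hS]
    simp only [add_mul, mul_add, Matrix.smul_mul, Matrix.mul_smul, projS_mul_projS,
      projT_mul_projT q hq.out, projS_mul_projT, projT_mul_projS, smul_zero, smul_smul,
      add_zero, zero_add, mul_inv_cancel₀ ha, mul_inv_cancel₀ hb, one_smul]
  calc T = matrixMap q (projS q + projT q + projA q) T := by
        rw [show projS q + projT q + projA q = 1 by rw [projS]; abel, matrixMap_one]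
    _ = matrixMap q (1 + S) (matrixMap q (a⁻¹ • projS q + b⁻¹ • projT q) T) := by
        rw [matrixMap_add, matrixMap_projA_dirac, add_zero, matrixMap_matrixMap, h1]
    _ = _ := by rw [matrixMap_add, matrixMap_one]

end Projectors

/-! ### The connections -/

section Connection

variable (q : ℝ) [hq : Fact (0 < q)]

/-- The connection `D ω = -θ ⊗ ω + σ (ω ⊗ θ)` for the generalized flip `σ` of a matrix `S`. -/
noncomputable def diracConnection (hq1 : q ≠ 1) (S : Matrix (Fin 3 × Fin 3) (Fin 3 × Fin 3) ℂ)
    (hS : ∀ t (a : Alg q), matrixMap q S (t <• a) = matrixMap q S t <• a) :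
    LinearConnection (d q) where
  D := -BTensor.mk (Alg q) _ _ (dirac q) +
    (matrixMap q S).comp ((BTensor.mk (Alg q) _ _).flip (dirac q))
  σ := matrixMap q S
  σ_left := matrixMap_smul q S
  σ_right := hS
  leibniz_left f ω := by
    change -tmul (Alg q) (dirac q) (f • ω) + matrixMap q S (tmul (Alg q) (f • ω) (dirac q)) =
      tmul (Alg q) (d q f) ω +
        f • (-tmul (Alg q) (dirac q) ω + matrixMap q S (tmul (Alg q) ω (dirac q)))
    rw [← left_smul_tmul, matrixMap_smul, d_eq q hq1, sub_tmul, ← BTensor.smul_tmul, smul_add,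
      smul_neg, left_smul_tmul]
    abel
  leibniz_right ω f := by
    change -tmul (Alg q) (dirac q) (ω <• f) + matrixMap q S (tmul (Alg q) (ω <• f) (dirac q)) =
      matrixMap q S (tmul (Alg q) ω (d q f)) +
        (-tmul (Alg q) (dirac q) ω + matrixMap q S (tmul (Alg q) ω (dirac q))) <• f
    rw [smul_add, smul_neg, op_smul_tmul, ← hS, op_smul_tmul, BTensor.smul_tmul,
      eq_add_of_sub_eq (d_eq q hq1 f).symm, tmul_add, map_add]
    abel

theorem IsD0.σ_eq {S : Matrix (Fin 3 × Fin 3) (Fin 3 × Fin 3) ℂ} {C : LinearConnection (d q)}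
    (hC : IsD0 q S C) : C.σ = matrixMap q S :=
  eq_matrixMap q S C.σ_left hC.1

theorem existsUnique_isD0 (hq1 : q ≠ 1) (S : Matrix (Fin 3 × Fin 3) (Fin 3 × Fin 3) ℂ)
    (hS : ∀ t (a : Alg q), matrixMap q S (t <• a) = matrixMap q S t <• a) :
    ∃! C : LinearConnection (d q), IsD0 q S C := by
  refine ⟨diracConnection q hq1 S hS, ⟨matrixMap_xi2 q S, fun ω => rfl⟩, fun C hC => ?_⟩
  refine LinearConnection.ext ?_ (hC.σ_eq q)
  ext ω
  rw [hC.2, hC.σ_eq]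
  rfl

theorem curvature_eq_zero {S : Matrix (Fin 3 × Fin 3) (Fin 3 × Fin 3) ℂ}
    (hr : ∀ t (a : Alg q), matrixMap q S (t <• a) = matrixMap q S t <• a)
    (hb : ∀ t, leg12 (matrixMap q S) hr (leg23 (matrixMap q S) (matrixMap_smul q S)
        (leg12 (matrixMap q S) hr t)) =
      leg23 (matrixMap q S) (matrixMap_smul q S) (leg12 (matrixMap q S) hr
        (leg23 (matrixMap q S) (matrixMap_smul q S) t)))
    {a b : ℂ} (ha : a ≠ 0) (hb' : b ≠ 0) (hS : 1 + S = a • projS q + b • projT q)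
    {C : LinearConnection (d q)} (hC : IsD0 q S C) :
    C.curvature (wedge q) (wedge_right q) = 0 := by
  obtain ⟨t, ht⟩ := dirac_tmul_dirac q ha hb' hS
  have hσ := hC.σ_eq q
  refine C.curvature_eq_zero_of_braid (wedge q) (wedge_right q) (dirac q) hC.2 ?_ ?_ (t₀ := t) ?_
  · simpa only [hσ] using hb
  · intro t
    rw [hσ, wedge_matrixMap q hS]
  · rw [hσ, ht]

end Connection

end QEuclid

theorem mainTheorem3 (q : ℝ) [Fact (0 < q)] (hq1 : q ≠ 1)
    (S : Matrix (Fin 3 × Fin 3) (Fin 3 × Fin 3) ℂ)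
    (hS : S = (q : ℂ) • QEuclid.braid q ∨ S = ((q : ℂ) • QEuclid.braid q)⁻¹) :
    (∃! C : LinearConnection (QEuclid.d q), QEuclid.IsD0 q S C) ∧
      ∀ C : LinearConnection (QEuclid.d q), QEuclid.IsD0 q S C →
        C.curvature (QEuclid.wedge q) (QEuclid.wedge_right q) = 0 := by
  have h : 0 < q := Fact.out
  have h1 : 1 + (q : ℂ) ≠ 0 := by exact_mod_cast (by positivity : 1 + q ≠ 0)
  have h2 : 1 + (q : ℂ) ^ 2 ≠ 0 := by exact_mod_cast (by positivity : 1 + q ^ 2 ≠ 0)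
  have h3 : 1 + (q : ℂ)⁻¹ ≠ 0 := by exact_mod_cast (by positivity : 1 + q⁻¹ ≠ 0)
  have h4 : 1 + ((q : ℂ) ^ 2)⁻¹ ≠ 0 := by exact_mod_cast (by positivity : 1 + (q ^ 2)⁻¹ ≠ 0)
  rcases hS with rfl | rfl
  · exact ⟨QEuclid.existsUnique_isD0 q hq1 _ (QEuclid.matrixMap_braid_op_smul q), fun C hC =>
      QEuclid.curvature_eq_zero q _ (QEuclid.leg_braid_yangBaxter q) h2 h3
        (QEuclid.one_add_braid q) hC⟩
  · exact ⟨QEuclid.existsUnique_isD0 q hq1 _ (QEuclid.matrixMap_inv_braid_op_smul q), fun C hC =>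
      QEuclid.curvature_eq_zero q _ (QEuclid.leg_inv_braid_yangBaxter q) h4 h1
        (QEuclid.one_add_inv_braid q) hC⟩
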